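/- Let $X=(X(t))_{t\ge 0}$ be a real-valued regenerative process: there are i.i.d. pairs $(T_k,\xi_k(\cdot))_{k\ge 1}$, consisting of a positive random variable $T_k$ and a random process $\xi_k=(\xi_k(s))_{s\ge 0}$, such that, with $S_0=0$ and $S_k=T_1+\dots+T_k$, one has $X(t)=\xi_k(t-S_{k-1})$ for $t\in[S_{k-1},S_k)$, $k\ge 1$. The maximum $\sup_{0\le s<T_k}\xi_k(s)$ over a cycle is supposed to be a measurable functional of $(T_k,\xi_k)$ (up to null sets). Put $\bar X(t)=\sup_{0\le s<t}X(s)$, $F(x)=\mathbf P(\bar X(T_1)\le x)$, $R(x)=-\log(1-F(x))$ for $x\in\mathbb R$, and $\alpha_T=\mathbf E T_1$. For $H:\mathbb R\to\mathbb R$ let $H^{-1}(y)=\inf\{x\in\mathbb R: H(x)>y\}$ be its generalized inverse. We say that $H$ satisfies condition $(\mathbb U)$ if $H(x)\to+\infty$ as $x\to+\infty$; $H$ is nondecreasing and differentiable on some neighbourhood of $+\infty$; $H^{-1}(y)$ is finite for all large $y$; and, with $h=H'$, the function $y\mapsto (H^{-1})'(y)=1/h(H^{-1}(y))$ is regularly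 varying at $+\infty$ with some index $\kappa\in\mathbb R$, that is, for large $y$ it equals $y^{\kappa}V(y)$, where $V$ is positive and measurable near $+\infty$ and $V(ty)/V(t)\to1$ as $t\to+\infty$ for every $y>0$. Assume that $\alpha_T<\infty$ and that $R(x)=R_0(x)+R_1(x)$ for all $x\in\mathbb R$, where $R_0,R_1:\mathbb R\to\mathbb R$, $\sup_{x\in\mathbb R}|R_1(x)|<\infty$ and $R_0$ satisfies condition $(\mathbb U)$. Let $r_0=R_0'$ (which exists for large arguments) and $A_0(t)=R_0^{-1}(\log(t/\alpha_T))$. Then $$\limsup_{t\to\infty}\frac{r_0(A_0(t))\,(\bar X(t)-A_0(t))}{\log\log t}=1\quad\text{a.s.}$$ and $$\liminf_{t\to\infty}\frac{r_0(A_0(t))\,(\bar X(t)-A_0(t))}{\log\log\log t}=-1\quad\text{a.s.}$$ -/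

import Mathlib

open MeasureTheory ProbabilityTheory Filter Topology
open scoped NNReal

/-- A real function `V` is slowly varying at `+∞`: it is positive and measurable in a
neighbourhood of `+∞`, and `V (t x) / V t → 1` as `t → +∞` for every `x > 0`. -/
def SlowlyVarying (V : ℝ → ℝ) : Prop :=
  (∃ a : ℝ, (∀ x ∈ Set.Ioi a, 0 < V x) ∧ Measurable ((Set.Ioi a).domRestrict V)) ∧
    ∀ x : ℝ, 0 < x → Tendsto (fun t : ℝ => V (t * x) / V t) atTop (𝓝 1)

/-- `U` is regularly varying at `+∞` with index `κ`: in a neighbourhood of `+∞`,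
`U x = x ^ κ * V x` with `V` slowly varying. -/
def RegularlyVarying (U : ℝ → ℝ) (κ : ℝ) : Prop :=
  ∃ V : ℝ → ℝ, SlowlyVarying V ∧ ∀ᶠ x : ℝ in atTop, U x = x ^ κ * V x

/-- The generalized inverse `H⁻¹(y) = inf {x : H x > y}`. -/
noncomputable def genInv (H : ℝ → ℝ) (y : ℝ) : ℝ :=
  sInf {x : ℝ | y < H x}

/-- Condition `(𝕌)` on a function `H : ℝ → ℝ`. -/
structure ConditionU (H : ℝ → ℝ) : Prop where
  tendsto_atTop : Tendsto H atTop atTop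
  eventually_monotone : ∃ x₀ : ℝ, MonotoneOn H (Set.Ici x₀)
  eventually_differentiable : ∀ᶠ x : ℝ in atTop, DifferentiableAt ℝ H x
  /-- The infimum defining `H⁻¹(y)` is not `-∞` for large `y`, so that `H⁻¹(y)` is a real number
  (the set is nonempty because `H` tends to `+∞`). -/
  eventually_bddBelow : ∀ᶠ y : ℝ in atTop, BddBelow {x : ℝ | y < H x}
  /-- `1 / h (H⁻¹(y)) = (H⁻¹)'(y)`, where `h = H'`, is regularly varying. Regular variation includes
  eventual positivity, so the convention `1 / 0 = 0` plays no role. -/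
  regularlyVarying : ∃ κ : ℝ, RegularlyVarying (fun y : ℝ => 1 / deriv H (genInv H y)) κ

section Regeneration

variable {Ω : Type*}

/-- The regeneration epochs `S 0 = 0`, `S k = T 0 + ⋯ + T (k - 1)`: the cycle lengths are indexed
from `0`. -/
def epoch (T : ℕ → Ω → ℝ≥0) (k : ℕ) (ω : Ω) : ℝ≥0 :=
  ∑ i ∈ Finset.range k, T i ω

/-- The supremum of a path over `[0, t)`, in the extended reals. -/
noncomputable def pathSup (f : ℝ≥0 → ℝ) (t : ℝ≥0) : EReal :=
  ⨆ s : Set.Iio t, (f s : EReal)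

/-- The running maximum `X̄(t) = sup_{0 ≤ s < t} X(s)`. -/
noncomputable def runningMax (X : ℝ≥0 → Ω → ℝ) (t : ℝ≥0) (ω : Ω) : EReal :=
  pathSup (fun s => X s ω) t

/-- `X` is a regenerative process with cycles `(T k, ξ k)`, `k = 0, 1, …`. The cycle paths `ξ k` are
random elements of a measurable space `E` of functions `ℝ≥0 → ℝ` on which evaluations are
measurable. The pairs `(T k, ξ k)` are independent and identically distributed, and on the `k`-th
period `[S k, S (k + 1))` the process is `X t = ξ k (t - S k)`. -/
structure IsRegenerative [MeasurableSpace Ω] (μ : Measure Ω)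
    {E : Type*} [FunLike E ℝ≥0 ℝ] [MeasurableSpace E]
    (T : ℕ → Ω → ℝ≥0) (ξ : ℕ → Ω → E) (X : ℝ≥0 → Ω → ℝ) : Prop where
  measurable_eval : ∀ s : ℝ≥0, Measurable (fun f : E => f s)
  measurable_length : ∀ k, Measurable (T k)
  measurable_path : ∀ k, Measurable (ξ k)
  length_pos : ∀ k, ∀ᵐ ω ∂μ, 0 < T k ω
  indep : iIndepFun (fun k ω => (T k ω, ξ k ω)) μ
  identDistrib : ∀ k, IdentDistrib (fun ω => (T k ω, ξ k ω)) (fun ω => (T 0 ω, ξ 0 ω)) μ μ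
  eq_on_cycle : ∀ᵐ ω ∂μ, ∀ k : ℕ, ∀ t ∈ Set.Ico (epoch T k ω) (epoch T (k + 1) ω),
    X t ω = ξ k ω (t - epoch T k ω)

/-- The distribution function `F x = P (X̄(T₁) ≤ x)` of the maximum over the first cycle. -/
noncomputable def cycleMaxCDF [MeasurableSpace Ω] (μ : Measure Ω)
    (T : ℕ → Ω → ℝ≥0) (X : ℝ≥0 → Ω → ℝ) (x : ℝ) : ℝ :=
  μ.real {ω | runningMax X (T 0 ω) ω ≤ (x : EReal)}

/-- `R x = -log (1 - F x)`. -/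
noncomputable def cycleMaxR [MeasurableSpace Ω] (μ : Measure Ω)
    (T : ℕ → Ω → ℝ≥0) (X : ℝ≥0 → Ω → ℝ) (x : ℝ) : ℝ :=
  -Real.log (1 - cycleMaxCDF μ T X x)

/-- The mean cycle length `α_T = E T₁`. -/
noncomputable def meanCycle [MeasurableSpace Ω] (μ : Measure Ω) (T : ℕ → Ω → ℝ≥0) : ℝ :=
  ∫ ω, (T 0 ω : ℝ) ∂μ

/-- `A₀(t) = R₀⁻¹(log (t / α))`. -/
noncomputable def centering (R₀ : ℝ → ℝ) (α : ℝ) (t : ℝ≥0) : ℝ :=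
  genInv R₀ (Real.log ((t : ℝ) / α))

/-- `r₀(A₀(t)) (X̄(t) - A₀(t))` with `r₀ = R₀'`. -/
noncomputable def normalizedMax (R₀ : ℝ → ℝ) (α : ℝ) (X : ℝ≥0 → Ω → ℝ) (t : ℝ≥0) (ω : Ω) : EReal :=
  ((deriv R₀ (centering R₀ α t) : ℝ) : EReal) * (runningMax X t ω - (centering R₀ α t : EReal))

end Regeneration

/-! Cut the path at the regeneration epochs. The cycle maxima are i.i.d. with tail `1 - F = exp
(-R)`, the running maximum at the `n`-th epoch is the maximum of the first `n` of them, and by the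
strong law `t ∼ α N(t)`, where `N(t)` counts the cycles completed by time `t`. The theorem thus
reduces to i.i.d. maxima and a change of variable.

Write `G = R₀⁻¹`. As `R₁` is bounded, `P(Y > G y)` lies between two constant multiples of `exp (-y)`
(`ConditionU.tail_bounds`), and such constants do not affect the iterated-logarithm scales. Four
Borel–Cantelli arguments locate the partial maxima. A single term exceeds `G (log n + c log log n)`
with probability of order `1 / (n (log n)^c)`, so `c = 1` is critical from above. All of `n` terms
stay below `G (log n - c log log log n)` with probability about `exp (-const (log log n)^c)`: for `c
> 1` this is summable along `n = 2^k`, for `c < 1` it is not along `n = 2^(k^2)`.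

Finally, `G' = U` is regularly varying, hence asymptotically constant on intervals short relative to
their position. So `G (log n + c ψ(log n)) - G (log (t / α))` is approximately `c ψ(log t) U(log (t
/ α))`, where `U(log (t / α)) = 1 / r₀(A₀(t))` is exactly the normalization
(`RegularlyVarying.tendsto_normalized`, `normalizedMax_bounds`). -/

/-! ### Regular variation. -/

/-- The uniform convergence theorem for slowly varying functions, in additive form. -/
theorem eventually_abs_sub_le_of_tendsto_add_sub {k : ℝ → ℝ} (hk : Measurable k)
    (h : ∀ u : ℝ, Tendsto (fun x => k (x + u) - k x) atTop (𝓝 0)) {ε : ℝ} (hε : 0 < ε) :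
    ∀ᶠ x in atTop, ∀ w : ℝ, |w| ≤ 1 → |k (x + w) - k x| ≤ ε := by
  -- Truncation at 1 supplies a dominating function and keeps the triangle inequality.
  set f : ℝ → ℝ → ℝ := fun x u => min 1 |k (x + u) - k x| with hf
  have f_nonneg : ∀ x u, 0 ≤ f x u := fun x u => le_min zero_le_one (abs_nonneg _)
  have f_meas : ∀ x, Measurable (f x) := fun x => by
    simp only [hf]
    fun_prop
  have f_int : ∀ x a b, IntervalIntegrable (f x) volume a b := fun x a b => by
    refine (intervalIntegrable_const (c := (1 : ℝ))).mono_fun (f_meas x).aestronglyMeasurable ?_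
    refine Eventually.of_forall fun u => ?_
    simp only [Real.norm_eq_abs, abs_of_nonneg (f_nonneg x u), abs_one]
    exact min_le_left _ _
  have hφ : Tendsto (fun x => ∫ u in (0 : ℝ)..4, f x u) atTop (𝓝 0) := by
    have := intervalIntegral.tendsto_integral_filter_of_dominated_convergence
      (μ := volume) (a := (0 : ℝ)) (b := 4) (F := f) (f := fun _ => (0 : ℝ)) (l := atTop)
      (fun _ => (1 : ℝ))
      (Eventually.of_forall fun x => (f_meas x).aestronglyMeasurable)
      (Eventually.of_forall fun x => Eventually.of_forall fun u _ => by
        simp only [Real.norm_eq_abs, abs_of_nonneg (f_nonneg x u)]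
        exact min_le_left _ _)
      intervalIntegrable_const
      (Eventually.of_forall fun u _ => by
        have := (tendsto_const_nhds (x := (1 : ℝ))).min (h u).abs
        simpa [hf] using this)
    simpa using this
  -- Compare `x` and `x + w` through a common third point `x + u` and average over `u ∈ [1, 2]`;
  -- then both `u` and `u - w` stay in `[0, 4]`, which gives a bound uniform in `w`.
  have key : ∀ x w : ℝ, |w| ≤ 1 →
      f x w ≤ (∫ u in (0 : ℝ)..4, f x u) + ∫ u in (0 : ℝ)..4, f (x + w) u := by
    intro x w hw
    obtain ⟨hw1, hw2⟩ := abs_le.1 hw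
    have hpt : ∀ u, f x w ≤ f x u + f (x + w) (u - w) := fun u => by
      have e : x + w + (u - w) = x + u := by ring
      simp only [hf, e]
      have h3 : |k (x + w) - k x| ≤ |k (x + u) - k x| + |k (x + u) - k (x + w)| := by
        have := abs_sub_le (k (x + w)) (k (x + u)) (k x)
        rw [abs_sub_comm (k (x + w)) (k (x + u))] at this
        linarith
      rcases le_total 1 |k (x + u) - k x| with h1 | h1
      · rw [min_eq_left h1]
        have := min_le_left 1 |k (x + w) - k x|
        have := le_min (zero_le_one' ℝ) (abs_nonneg (k (x + u) - k (x + w)))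
        linarith
      · rcases le_total 1 |k (x + u) - k (x + w)| with h2 | h2
        · rw [min_eq_left h2]
          have := min_le_left 1 |k (x + w) - k x|
          have := le_min (zero_le_one' ℝ) (abs_nonneg (k (x + u) - k x))
          linarith
        · rw [min_eq_right h1, min_eq_right h2]
          exact (min_le_right _ _).trans h3
    have shift_int : IntervalIntegrable (fun u => f (x + w) (u - w)) volume 1 2 := by
      have := (f_int (x + w) (1 - w) (2 - w)).comp_sub_right w
      simpa using this
    have h1 : (∫ _ in (1 : ℝ)..2, f x w) ≤ ∫ u in (1 : ℝ)..2, (f x u + f (x + w) (u - w)) :=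
      intervalIntegral.integral_mono_on (by norm_num) intervalIntegrable_const
        ((f_int x 1 2).add shift_int) fun u _ => hpt u
    rw [intervalIntegral.integral_add (f_int x 1 2) shift_int,
      intervalIntegral.integral_comp_sub_right (fun u => f (x + w) u) w,
      intervalIntegral.integral_const] at h1
    have h2 : ∫ u in (1 : ℝ)..2, f x u ≤ ∫ u in (0 : ℝ)..4, f x u :=
      intervalIntegral.integral_mono_interval (by norm_num) (by norm_num) (by norm_num)
        (Eventually.of_forall (f_nonneg x)) (f_int x 0 4)
    have h3 : ∫ u in (1 - w)..(2 - w), f (x + w) u ≤ ∫ u in (0 : ℝ)..4, f (x + w) u :=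
      intervalIntegral.integral_mono_interval (by linarith) (by linarith) (by linarith)
        (Eventually.of_forall (f_nonneg _)) (f_int _ 0 4)
    have h4 : ((2 : ℝ) - 1) • f x w = f x w := by norm_num
    linarith
  obtain ⟨a, ha⟩ := eventually_atTop.1
    (hφ.eventually (gt_mem_nhds (show (0 : ℝ) < min 1 ε / 2 by positivity)))
  filter_upwards [eventually_ge_atTop (a + 1)] with x hx w hw
  have h1 := ha x (by linarith)
  have h2 := ha (x + w) (by linarith [(abs_le.1 hw).1])
  have h3 := key x w hw
  have h4 : f x w < min 1 ε := by linarith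
  have h5 : f x w < 1 := h4.trans_le (min_le_left _ _)
  have h6 : f x w = |k (x + w) - k x| := by
    rcases min_choice 1 |k (x + w) - k x| with h | h
    · simp only [hf] at h5
      rw [h] at h5
      exact absurd h5 (lt_irrefl _)
    · exact h
  rw [← h6]
  exact (h4.trans_le (min_le_right _ _)).le

/-- In logarithmic coordinates the quotient condition becomes a shift tending to 0, and the uniform
convergence theorem allows the shift to vary with the index. -/
theorem SlowlyVarying.tendsto_div {V : ℝ → ℝ} (hV : SlowlyVarying V) {ι : Type*} {l : Filter ι}
    {y z : ι → ℝ} (hy : Tendsto y l atTop) (h : Tendsto (fun i => z i / y i) l (𝓝 1)) :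
    Tendsto (fun i => V (z i) / V (y i)) l (𝓝 1) := by
  obtain ⟨⟨a, hpos, hmeas⟩, hlim⟩ := hV
  -- `V` is measurable only beyond `a`; extension by zero makes it measurable on the whole line.
  set W : ℝ → ℝ := (Set.Ioi a).indicator V with hW
  have hWm : Measurable W := by
    refine measurable_of_restrict_of_restrict_compl (s := Set.Ioi a) measurableSet_Ioi ?_ ?_
    · exact (funext fun x => Set.indicator_of_mem x.2 V :
        (Set.Ioi a).domRestrict W = (Set.Ioi a).domRestrict V) ▸ hmeas
    · exact (funext fun x => Set.indicator_of_notMem x.2 V :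
        (Set.Ioi a)ᶜ.domRestrict W = fun _ => 0) ▸ measurable_const
  set k : ℝ → ℝ := fun x => Real.log (W (Real.exp x)) with hk
  have hkm : Measurable k := by
    simp only [hk]
    fun_prop
  have hWV : ∀ x, a < x → W x = V x := fun x hx => Set.indicator_of_mem (Set.mem_Ioi.2 hx) _
  have hkV : ∀ x, a < Real.exp x → k x = Real.log (V (Real.exp x)) := fun x hx => by
    simp only [hk, hWV _ hx]
  have hk0 : ∀ u : ℝ, Tendsto (fun x => k (x + u) - k x) atTop (𝓝 0) := by
    intro u
    have h1 := ((hlim (Real.exp u) (Real.exp_pos u)).comp Real.tendsto_exp_atTop).log one_ne_zero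
    rw [Real.log_one] at h1
    refine h1.congr' ?_
    have e1 : ∀ᶠ x in atTop, a < Real.exp x := Real.tendsto_exp_atTop.eventually_gt_atTop a
    have e2 : ∀ᶠ x in atTop, a < Real.exp (x + u) :=
      (Real.tendsto_exp_atTop.comp
        (tendsto_atTop_add_const_right _ u tendsto_id)).eventually_gt_atTop a
    filter_upwards [e1, e2] with x h1 h2
    rw [hkV _ h1, hkV _ h2, ← Real.log_div (hpos _ h2).ne' (hpos _ h1).ne', Real.exp_add]
    rfl
  have hz : Tendsto z l atTop := by
    have := hy.atTop_mul_pos one_pos h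
    refine this.congr' ?_
    filter_upwards [hy.eventually_gt_atTop 0] with i hi
    field_simp
  have hw : Tendsto (fun i => Real.log (z i) - Real.log (y i)) l (𝓝 0) := by
    have h1 := h.log one_ne_zero
    rw [Real.log_one] at h1
    refine h1.congr' ?_
    filter_upwards [hy.eventually_gt_atTop 0, hz.eventually_gt_atTop 0] with i hi hi'
    rw [Real.log_div hi'.ne' hi.ne']
  have hly : Tendsto (fun i => Real.log (y i)) l atTop := Real.tendsto_log_atTop.comp hy
  have hdiff : Tendsto (fun i => k (Real.log (z i)) - k (Real.log (y i))) l (𝓝 0) := by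
    rw [Metric.tendsto_nhds]
    intro ε hε
    have hu := hly.eventually (eventually_abs_sub_le_of_tendsto_add_sub hkm hk0 (half_pos hε))
    have hw1 : ∀ᶠ i in l, |Real.log (z i) - Real.log (y i)| < 1 := by
      have := hw.abs
      rw [abs_zero] at this
      exact this.eventually (gt_mem_nhds one_pos)
    filter_upwards [hu, hw1] with i hi hi'
    have := hi _ hi'.le
    rw [add_sub_cancel] at this
    rw [Real.dist_eq, sub_zero]
    linarith
  have hexp := (Real.continuous_exp.tendsto 0).comp hdiff
  rw [Real.exp_zero] at hexp
  refine hexp.congr' ?_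
  filter_upwards [hy.eventually_gt_atTop 0, hz.eventually_gt_atTop 0, hy.eventually_gt_atTop a,
    hz.eventually_gt_atTop a] with i h1 h2 h3 h4
  have e1 : Real.exp (Real.log (y i)) = y i := Real.exp_log h1
  have e2 : Real.exp (Real.log (z i)) = z i := Real.exp_log h2
  simp only [Function.comp]
  rw [hkV _ (by rwa [e2]), hkV _ (by rwa [e1]), e1, e2, Real.exp_sub, Real.exp_log (hpos _ h4),
    Real.exp_log (hpos _ h3)]

theorem RegularlyVarying.tendsto_div {U : ℝ → ℝ} {κ : ℝ} (hU : RegularlyVarying U κ)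
    {ι : Type*} {l : Filter ι} {y z : ι → ℝ} (hy : Tendsto y l atTop)
    (h : Tendsto (fun i => z i / y i) l (𝓝 1)) :
    Tendsto (fun i => U (z i) / U (y i)) l (𝓝 1) := by
  obtain ⟨V, hV, hUV⟩ := hU
  have hz : Tendsto z l atTop := by
    have := hy.atTop_mul_pos one_pos h
    refine this.congr' ?_
    filter_upwards [hy.eventually_gt_atTop 0] with i hi
    field_simp
  have h1 := (h.rpow_const (p := κ) (Or.inl one_ne_zero)).mul (hV.tendsto_div hy h)
  rw [Real.one_rpow, one_mul] at h1
  refine h1.congr' ?_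
  filter_upwards [hy.eventually_gt_atTop 0, hz.eventually_gt_atTop 0, hy.eventually hUV,
    hz.eventually hUV] with i h1 h2 h3 h4
  rw [h3, h4, Real.div_rpow h2.le h1.le, div_mul_div_comm]

theorem RegularlyVarying.eventually_pos {U : ℝ → ℝ} {κ : ℝ} (hU : RegularlyVarying U κ) :
    ∀ᶠ y in atTop, 0 < U y := by
  obtain ⟨V, ⟨⟨a, hpos, -⟩, -⟩, hUV⟩ := hU
  filter_upwards [hUV, eventually_gt_atTop a, eventually_gt_atTop 0] with y h1 h2 h3
  rw [h1]
  exact mul_pos (Real.rpow_pos_of_pos h3 _) (hpos _ h2)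

/-- Increments of a primitive of a regularly varying function over relatively short intervals. -/
theorem RegularlyVarying.tendsto_sub_div {U G : ℝ → ℝ} {κ : ℝ} (hU : RegularlyVarying U κ)
    (hG : ∀ᶠ y in atTop, HasDerivAt G (U y) y) {ι : Type*} {l : Filter ι} {y z L : ι → ℝ} {c : ℝ}
    (hy : Tendsto y l atTop) (hz : Tendsto (fun i => (z i - y i) / y i) l (𝓝 0))
    (hL : Tendsto (fun i => (z i - y i) / L i) l (𝓝 c)) :
    Tendsto (fun i => (G (z i) - G (y i)) / U (y i) / L i) l (𝓝 c) := by
  obtain ⟨a, ha⟩ := eventually_atTop.1 hG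
  have hzy : Tendsto (fun i => z i / y i) l (𝓝 1) := by
    have := hz.const_add 1
    rw [add_zero] at this
    refine this.congr' ?_
    filter_upwards [hy.eventually_gt_atTop 0] with i hi
    field_simp
    ring
  have hz' : Tendsto z l atTop := by
    have := hy.atTop_mul_pos one_pos hzy
    refine this.congr' ?_
    filter_upwards [hy.eventually_gt_atTop 0] with i hi
    field_simp
  -- Mean value theorem. The intermediate point is asymptotic to `y i`, so the value of `U` there
  -- may be replaced by `U (y i)`.
  have hmvt : ∀ᶠ i in l, ∃ x ∈ Set.uIcc (y i) (z i), G (z i) - G (y i) = U x * (z i - y i) := by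
    filter_upwards [hy.eventually_ge_atTop a, hz'.eventually_ge_atTop a] with i h1 h2
    rcases lt_trichotomy (y i) (z i) with h | h | h
    · obtain ⟨x, hx, hx'⟩ := exists_hasDerivAt_eq_slope G U h
        (fun x hx => (ha x (h1.trans hx.1)).continuousAt.continuousWithinAt)
        (fun x hx => ha x (h1.trans hx.1.le))
      refine ⟨x, Set.uIcc_of_le h.le ▸ Set.Ioo_subset_Icc_self hx, ?_⟩
      rw [hx', div_mul_cancel₀ _ (sub_pos.2 h).ne']
    · exact ⟨y i, Set.left_mem_uIcc, by rw [h]; ring⟩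
    · obtain ⟨x, hx, hx'⟩ := exists_hasDerivAt_eq_slope G U h
        (fun x hx => (ha x (h2.trans hx.1)).continuousAt.continuousWithinAt)
        (fun x hx => ha x (h2.trans hx.1.le))
      refine ⟨x, Set.uIcc_of_ge h.le ▸ Set.Ioo_subset_Icc_self hx, ?_⟩
      rw [hx', ← neg_sub (y i) (z i), mul_neg, div_mul_cancel₀ _ (sub_pos.2 h).ne']
      ring
  choose! x hx hx' using hmvt.exists_mem.choose_spec.2
  have hmem := hmvt.exists_mem.choose_spec.1
  have hxy : Tendsto (fun i => x i / y i) l (𝓝 1) := by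
    have hlow := (tendsto_const_nhds (x := (1 : ℝ))).min hzy
    have hupp := (tendsto_const_nhds (x := (1 : ℝ))).max hzy
    rw [min_self] at hlow
    rw [max_self] at hupp
    refine tendsto_of_tendsto_of_tendsto_of_le_of_le' hlow hupp ?_ ?_
    · filter_upwards [hmem, hy.eventually_gt_atTop 0] with i h1 h2
      have h3 := (hx i h1).1
      rw [le_div_iff₀ h2, min_mul_of_nonneg _ _ h2.le, one_mul, div_mul_cancel₀ _ h2.ne']
      exact h3
    · filter_upwards [hmem, hy.eventually_gt_atTop 0] with i h1 h2
      have h3 := (hx i h1).2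
      rw [div_le_iff₀ h2, max_mul_of_nonneg _ _ h2.le, one_mul, div_mul_cancel₀ _ h2.ne']
      exact h3
  have hfin := (hU.tendsto_div hy hxy).mul hL
  rw [one_mul] at hfin
  refine hfin.congr' ?_
  filter_upwards [hmem] with i h1
  rw [hx' i h1]
  ring

/-! ### The generalized inverse. -/

theorem genInv_set_nonempty {H : ℝ → ℝ} (hH : Tendsto H atTop atTop) (y : ℝ) :
    {x : ℝ | y < H x}.Nonempty :=
  (hH.eventually_gt_atTop y).exists

/-- The generalized inverse tends to `+∞` if `H` is bounded above on left half-lines. -/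
theorem tendsto_genInv {H : ℝ → ℝ} (hH : Tendsto H atTop atTop)
    (hb : ∀ b : ℝ, ∀ᶠ y in atTop, ∀ x, y < H x → b < x) : Tendsto (genInv H) atTop atTop := by
  refine tendsto_atTop.2 fun b => ?_
  filter_upwards [hb b] with y hy
  exact le_csInf (genInv_set_nonempty hH y) fun x hx => (hy x hx).le

theorem genInv_mono {H : ℝ → ℝ} (hH : Tendsto H atTop atTop) {y z : ℝ} (hyz : y ≤ z)
    (hy : BddBelow {x : ℝ | y < H x}) : genInv H y ≤ genInv H z :=
  csInf_le_csInf hy (genInv_set_nonempty hH z) fun _ hx => hyz.trans_lt hx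

theorem ConditionU.exists_monotoneOn_genInv {H : ℝ → ℝ} (hH : ConditionU H) :
    ∃ b, MonotoneOn (genInv H) (Set.Ici b) := by
  obtain ⟨b, hb⟩ := eventually_atTop.1 hH.eventually_bddBelow
  exact ⟨b, fun y hy z _ hyz => genInv_mono hH.tendsto_atTop hyz (hb y hy)⟩

/-- Continuity of `H` at the infimum: values to its left are at most `y`, and points with values
above `y` accumulate at it. The assumption `hb` pushes the infimum into the region where `H` is
differentiable. -/
theorem ConditionU.eventually_apply_genInv {H : ℝ → ℝ} (hH : ConditionU H)
    (hb : ∀ b : ℝ, ∀ᶠ y in atTop, ∀ x, y < H x → b < x) : ∀ᶠ y in atTop, H (genInv H y) = y := by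
  have hG := tendsto_genInv hH.tendsto_atTop hb
  filter_upwards [hG.eventually hH.eventually_differentiable, hH.eventually_bddBelow] with y hd hy
  have hne := genInv_set_nonempty hH.tendsto_atTop y
  apply le_antisymm
  · refine le_of_tendsto
      (hd.continuousAt.tendsto.mono_left (nhdsWithin_le_nhds (s := Set.Iio (genInv H y)))) ?_
    filter_upwards [self_mem_nhdsWithin] with x hx
    exact not_lt.1 fun h => (notMem_of_lt_csInf hx hy) h
  · have hcl := csInf_mem_closure hne hy
    obtain ⟨u, hu, hlim⟩ := mem_closure_iff_seq_limit.1 hcl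
    exact ge_of_tendsto' (hd.continuousAt.tendsto.comp hlim) fun n => (hu n).le

/-- The inverse function theorem applies once `genInv H` is continuous. Only a flat piece of `H`
ending at the infimum could cause a jump, and the positive derivative forced by regular variation
excludes it. -/
theorem ConditionU.eventually_hasDerivAt_genInv {H : ℝ → ℝ} (hH : ConditionU H)
    (hb : ∀ b : ℝ, ∀ᶠ y in atTop, ∀ x, y < H x → b < x) :
    ∀ᶠ y in atTop, HasDerivAt (genInv H) (1 / deriv H (genInv H y)) y := by
  have hG := tendsto_genInv hH.tendsto_atTop hb
  obtain ⟨κ, hκ⟩ := hH.regularlyVarying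
  obtain ⟨x₀, hx₀⟩ := hH.eventually_monotone
  have hbdd : ∀ᶠ y in atTop, ∀ᶠ z in 𝓝 y, BddBelow {x : ℝ | z < H x} :=
    (eventually_atTop.1 hH.eventually_bddBelow).elim fun b hb =>
      (eventually_gt_atTop b).mono fun y hy => (lt_mem_nhds hy).mono fun z hz => hb z hz.le
  have hloc : ∀ᶠ y in atTop, ∀ᶠ z in 𝓝 y, ∀ x, z < H x → x₀ < x :=
    (eventually_atTop.1 (hb x₀)).elim fun b hb =>
      (eventually_gt_atTop b).mono fun y hy => (lt_mem_nhds hy).mono fun z hz => hb z hz.le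
  have hinv : ∀ᶠ y in atTop, ∀ᶠ z in 𝓝 y, H (genInv H z) = z :=
    (eventually_atTop.1 (hH.eventually_apply_genInv hb)).elim fun b hb =>
      (eventually_gt_atTop b).mono fun y hy => (lt_mem_nhds hy).mono fun z hz => hb z hz.le
  filter_upwards [hκ.eventually_pos, hbdd, hloc, hinv,
    hG.eventually hH.eventually_differentiable, hG.eventually_gt_atTop x₀] with
    y hpos hbd hlo hin hd hgt
  have hder : 0 < deriv H (genInv H y) := one_div_pos.1 hpos
  -- If `H x = y` to the left of the infimum, monotonicity makes `H` constant up to it, so the left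
  -- derivative there is 0.
  have hlt : ∀ x, x₀ ≤ x → x < genInv H y → H x < y := by
    intro x hx hxy
    refine lt_of_le_of_ne (not_lt.1 fun h => notMem_of_lt_csInf hxy hbd.self_of_nhds h) fun heq => ?_
    have hconst : ∀ᶠ w in 𝓝[<] (genInv H y), H w = y := by
      filter_upwards [Ioo_mem_nhdsLT hxy] with w hw
      apply le_antisymm
      · exact not_lt.1 fun h => notMem_of_lt_csInf hw.2 hbd.self_of_nhds h
      · exact heq ▸ hx₀ (Set.mem_Ici.2 hx) (Set.mem_Ici.2 (hx.trans hw.1.le)) hw.1.le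
    have h1 : HasDerivWithinAt H 0 (Set.Iio (genInv H y)) (genInv H y) :=
      (hasDerivWithinAt_const _ _ y).congr_of_eventuallyEq hconst hin.self_of_nhds
    have h2 : HasDerivWithinAt H (deriv H (genInv H y)) (Set.Iio (genInv H y)) (genInv H y) :=
      hd.hasDerivAt.hasDerivWithinAt
    have := (uniqueDiffWithinAt_Iio (genInv H y)).eq_deriv _ h1 h2
    exact hder.ne this
  have hcont : ContinuousAt (genInv H) y := by
    refine tendsto_order.2 ⟨fun x hx => ?_, fun x hx => ?_⟩
    · obtain ⟨x', h1, h2⟩ := exists_between (max_lt hx hgt)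
      have h3 := hlt x' ((le_max_right _ _).trans h1.le) h2
      filter_upwards [lt_mem_nhds h3, hlo] with z hz hloz
      refine ((le_max_left x x₀).trans_lt h1).trans_le
        (le_csInf (genInv_set_nonempty hH.tendsto_atTop z) fun w hw => ?_)
      by_contra! hlt'
      have := hx₀ (Set.mem_Ici.2 (hloz w hw).le)
        (Set.mem_Ici.2 ((le_max_right _ _).trans h1.le)) hlt'.le
      exact absurd (hz.trans hw) (not_lt.2 this)
    · obtain ⟨w, hw, hwx⟩ := exists_lt_of_csInf_lt (genInv_set_nonempty hH.tendsto_atTop y) hx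
      filter_upwards [gt_mem_nhds hw, hbd] with z hz hbz
      exact (csInf_le hbz hz).trans_lt hwx
  rw [one_div]
  exact HasDerivAt.of_local_left_inverse hcont hd.hasDerivAt hder.ne' hin

/-! ### Borel–Cantelli lemmas and independence of blocks. -/

section BorelCantelli

variable {Ω : Type*} [MeasurableSpace Ω] {μ : Measure Ω}

theorem ae_eventually_notMem_of_summable [IsFiniteMeasure μ] {s : ℕ → Set Ω} {f : ℕ → ℝ}
    (hf : Summable f) (h : ∀ᶠ k in atTop, μ.real (s k) ≤ f k) :
    ∀ᵐ ω ∂μ, ∀ᶠ k in atTop, ω ∉ s k := by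
  have hsum : Summable fun k => μ.real (s k) :=
    Summable.of_norm_bounded_eventually_nat hf
      (h.mono fun k hk => by rwa [Real.norm_of_nonneg measureReal_nonneg])
  refine ae_eventually_notMem ?_
  have := hsum.tsum_ofReal_ne_top
  simp only [ofReal_measureReal (measure_ne_top μ _)] at this
  exact this

theorem ae_frequently_mem_of_not_summable [IsProbabilityMeasure μ] {s : ℕ → Set Ω} {f : ℕ → ℝ}
    (hs : ∀ k, MeasurableSet (s k)) (hind : iIndepSet s μ) (hf : ¬ Summable f)
    (hf0 : ∀ᶠ k in atTop, 0 ≤ f k) (h : ∀ᶠ k in atTop, f k ≤ μ.real (s k)) :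
    ∀ᵐ ω ∂μ, ∃ᶠ k in atTop, ω ∈ s k := by
  have htop : ∑' k, μ (s k) = ⊤ := by
    by_contra hne
    refine hf (Summable.of_norm_bounded_eventually_nat (ENNReal.summable_toReal hne) ?_)
    filter_upwards [h, hf0] with k hk hk0
    rwa [Real.norm_of_nonneg hk0]
  have h1 := measure_limsup_eq_one hs hind htop
  have h2 : ∀ᵐ ω ∂μ, ω ∈ limsup s atTop :=
    (mem_ae_iff_prob_eq_one (MeasurableSet.measurableSet_limsup hs)).2 h1
  filter_upwards [h2] with ω hω
  exact mem_limsup_iff_frequently_mem.1 hω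

theorem iIndepFun.iIndepSet_biInter_preimage {β : Type*} [MeasurableSpace β] {Y : ℕ → Ω → β}
    (hm : ∀ i, Measurable (Y i)) (hind : iIndepFun Y μ) {J : ℕ → Finset ℕ}
    (hJ : Pairwise fun k l => Disjoint (J k) (J l)) {A : ℕ → Set β}
    (hA : ∀ k, MeasurableSet (A k)) : iIndepSet (fun k => ⋂ i ∈ J k, Y i ⁻¹' A k) μ := by
  classical
  have hmeas : ∀ k, MeasurableSet (⋂ i ∈ J k, Y i ⁻¹' A k) := fun k =>
    Finset.measurableSet_biInter _ fun i _ => hm i (hA k)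
  refine (iIndepSet_iff_meas_biInter hmeas).2 fun s => ?_
  -- Disjointness of the blocks lets one condition per index replace one condition per block.
  have hex : ∀ i, ∃ B : Set β, MeasurableSet B ∧ ∀ k, i ∈ J k → B = A k := fun i => by
    by_cases h : ∃ k, i ∈ J k
    · obtain ⟨k, hk⟩ := h
      refine ⟨A k, hA k, fun l hl => ?_⟩
      by_contra hne
      have hkl : k ≠ l := fun e => hne (by rw [e])
      exact Finset.disjoint_left.1 (hJ hkl) hk hl
    · exact ⟨∅, MeasurableSet.empty, fun k hk => absurd ⟨k, hk⟩ h⟩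
  choose B hB hBA using hex
  have hinter : ∀ k, (⋂ i ∈ J k, Y i ⁻¹' A k) = ⋂ i ∈ J k, Y i ⁻¹' B i := fun k =>
    Set.iInter₂_congr fun i hi => by rw [hBA i k hi]
  have hprod : ∀ S : Finset ℕ, μ (⋂ i ∈ S, Y i ⁻¹' B i) = ∏ i ∈ S, μ (Y i ⁻¹' B i) := fun S =>
    hind.measure_inter_preimage_eq_mul S fun i _ => hB i
  simp only [hinter, hprod]
  rw [← Finset.prod_biUnion fun k _ l _ hkl => hJ hkl, ← hprod, Finset.set_biInter_biUnion]

end BorelCantelli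

/-! ### Limits of iterated logarithms and a divergent series. -/

theorem tendsto_log_log : Tendsto (fun t : ℝ => Real.log (Real.log t)) atTop atTop :=
  Real.tendsto_log_atTop.comp Real.tendsto_log_atTop

theorem tendsto_natLog_two : Tendsto (fun n : ℕ => Nat.log 2 n) atTop atTop := by
  refine tendsto_atTop.2 fun k => ?_
  filter_upwards [eventually_ge_atTop (2 ^ k)] with n hn
  exact Nat.le_log_of_pow_le one_lt_two hn

theorem tendsto_log_natCast : Tendsto (fun n : ℕ => Real.log n) atTop atTop :=
  Real.tendsto_log_atTop.comp tendsto_natCast_atTop_atTop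

theorem tendsto_log_div_id : Tendsto (fun s : ℝ => Real.log s / s) atTop (𝓝 0) :=
  Real.isLittleO_log_id_atTop.tendsto_div_nhds_zero

theorem tendsto_log_log_div_id : Tendsto (fun s : ℝ => Real.log (Real.log s) / s) atTop (𝓝 0) := by
  have h := (tendsto_log_div_id.comp Real.tendsto_log_atTop).mul tendsto_log_div_id
  rw [zero_mul] at h
  refine h.congr' ?_
  filter_upwards [Real.tendsto_log_atTop.eventually_gt_atTop 0] with s hs
  simp only [Function.comp]
  field_simp

theorem tendsto_sub_mul_log_log (c : ℝ) :
    Tendsto (fun s : ℝ => s - c * Real.log (Real.log s)) atTop atTop := by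
  have h := (tendsto_log_log_div_id.const_mul c).const_sub 1
  rw [mul_zero, sub_zero] at h
  refine (tendsto_id.atTop_mul_pos one_pos h).congr' ?_
  filter_upwards [eventually_gt_atTop 0] with s hs
  simp only [id]
  field_simp

theorem tendsto_add_mul_log {c : ℝ} (hc : 0 ≤ c) :
    Tendsto (fun s : ℝ => s + c * Real.log s) atTop atTop := by
  refine tendsto_atTop_mono' _ ?_ tendsto_id
  filter_upwards [eventually_ge_atTop 1] with s hs
  have := mul_nonneg hc (Real.log_nonneg hs)
  simp only [id]
  linarith

theorem not_summable_one_div_natCast_mul_log :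
    ¬ Summable fun n : ℕ => 1 / ((n : ℝ) * Real.log n) := by
  rw [← summable_condensed_iff_of_eventually_nonneg]
  · have hlog : Real.log 2 ≠ 0 := (Real.log_pos one_lt_two).ne'
    have e : (fun k : ℕ => (2 : ℝ) ^ k * (1 / (((2 ^ k : ℕ) : ℝ) * Real.log ((2 ^ k : ℕ) : ℝ)))) =
        fun k : ℕ => (Real.log 2)⁻¹ * (1 / (k : ℝ)) := by
      funext k
      push_cast
      rw [Real.log_pow]
      rcases Nat.eq_zero_or_pos k with rfl | hk
      · simp
      · have : (k : ℝ) ≠ 0 := by positivity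
        field_simp
    rw [e, summable_mul_left_iff (inv_ne_zero hlog)]
    exact Real.not_summable_one_div_natCast
  · filter_upwards [eventually_ge_atTop 1] with n hn
    have : 0 ≤ Real.log n := Real.log_nonneg (by exact_mod_cast hn)
    positivity
  · filter_upwards [eventually_ge_atTop 2] with n hn
    have h1 : (1 : ℝ) < n := by exact_mod_cast hn
    have h2 : 0 < Real.log n := Real.log_pos h1
    push_cast
    gcongr <;> linarith

/-! ### Almost sure bounds for maxima of i.i.d. variables. -/

section Maxima

/-- The maximum of the first `n` terms of a sequence of extended random variables. -/
noncomputable def partialMax {Ω : Type*} (Y : ℕ → Ω → EReal) (n : ℕ) (ω : Ω) : EReal :=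
  (Finset.range n).sup fun i => Y i ω

theorem partialMax_mono {Ω : Type*} (Y : ℕ → Ω → EReal) (ω : Ω) : Monotone fun n => partialMax Y n ω :=
  fun _ _ h => Finset.sup_mono (Finset.range_mono h)

variable {Ω : Type*} [MeasurableSpace Ω] {μ : Measure Ω} {Y : ℕ → Ω → EReal} {G : ℝ → ℝ}
  {c d D : ℝ}

theorem measureReal_lt_eq (hid : ∀ i, IdentDistrib (Y i) (Y 0) μ μ) (i : ℕ) (x : ℝ) :
    μ.real {ω | (x : EReal) < Y i ω} = μ.real {ω | (x : EReal) < Y 0 ω} := by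
  have := (hid i).measure_mem_eq (measurableSet_Ioi (a := (x : EReal)))
  simp only [measureReal_def]
  congr 1

theorem measureReal_lt_partialMax_le (hid : ∀ i, IdentDistrib (Y i) (Y 0) μ μ) (n : ℕ) (x : ℝ) :
    μ.real {ω | (x : EReal) < partialMax Y n ω} ≤ n * μ.real {ω | (x : EReal) < Y 0 ω} := by
  have : {ω | (x : EReal) < partialMax Y n ω} = ⋃ i ∈ Finset.range n, {ω | (x : EReal) < Y i ω} := by
    ext ω
    simp [partialMax, Finset.lt_sup_iff]
  rw [this]
  refine (measureReal_biUnion_finset_le _ _).trans ?_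
  simp [measureReal_lt_eq hid]

variable [IsProbabilityMeasure μ]

theorem measureReal_biInter_le (hm : ∀ i, Measurable (Y i)) (hind : iIndepFun Y μ)
    (hid : ∀ i, IdentDistrib (Y i) (Y 0) μ μ) (S : Finset ℕ) (x : ℝ) :
    μ.real (⋂ i ∈ S, Y i ⁻¹' Set.Iic (x : EReal)) =
      (1 - μ.real {ω | (x : EReal) < Y 0 ω}) ^ S.card := by
  have h1 : ∀ i, μ.real (Y i ⁻¹' Set.Iic (x : EReal)) = 1 - μ.real {ω | (x : EReal) < Y 0 ω} := by
    intro i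
    rw [← measureReal_lt_eq hid i, ← probReal_compl_eq_one_sub
      (s := {ω | (x : EReal) < Y i ω}) (hm i measurableSet_Ioi)]
    congr 1
    ext ω
    simp
  rw [measureReal_def, hind.measure_inter_preimage_eq_mul S (sets := fun _ => Set.Iic (x : EReal))
    fun i _ => measurableSet_Iic, ENNReal.toReal_prod]
  simp only [← measureReal_def, h1, Finset.prod_const]

theorem measureReal_partialMax_le (hm : ∀ i, Measurable (Y i)) (hind : iIndepFun Y μ)
    (hid : ∀ i, IdentDistrib (Y i) (Y 0) μ μ) (n : ℕ) (x : ℝ) :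
    μ.real {ω | partialMax Y n ω ≤ (x : EReal)} ≤
      Real.exp (-(n * μ.real {ω | (x : EReal) < Y 0 ω})) := by
  have : {ω | partialMax Y n ω ≤ (x : EReal)} =
      ⋂ i ∈ Finset.range n, Y i ⁻¹' Set.Iic (x : EReal) := by
    ext ω
    simp [partialMax, Finset.sup_le_iff]
  rw [this, measureReal_biInter_le hm hind hid, Finset.card_range, neg_mul_eq_mul_neg,
    Real.exp_nat_mul]
  refine pow_le_pow_left₀ (sub_nonneg.2 measureReal_le_one) ?_ n
  have := Real.add_one_le_exp (-μ.real {ω | (x : EReal) < Y 0 ω})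
  linarith

/-- Almost surely the partial maxima are eventually below `G (log n + c log log n)`, `c > 1`. -/
theorem ae_eventually_partialMax_le (hid : ∀ i, IdentDistrib (Y i) (Y 0) μ μ)
    (hG : ∃ b, MonotoneOn G (Set.Ici b))
    (hupp : ∀ᶠ y in atTop, μ.real {ω | (G y : EReal) < Y 0 ω} ≤ D * Real.exp (-y))
    (hc : 1 < c) :
    ∀ᵐ ω ∂μ, ∀ᶠ n : ℕ in atTop,
      partialMax Y n ω ≤ (G (Real.log n + c * Real.log (Real.log n)) : EReal) := by
  obtain ⟨b, hb⟩ := hG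
  have hlog2 : 0 < Real.log 2 := Real.log_pos one_lt_two
  -- For `2^k ≤ n < 2^(k+1)`, the threshold is taken at the left endpoint and the maximum at the
  -- right one; the union bound is then of order `k^(-c)`.
  set a : ℝ → ℝ := fun s => s + c * Real.log s with ha
  have ha_top : Tendsto a atTop atTop := tendsto_add_mul_log (by linarith)
  have hk_top : Tendsto (fun k : ℕ => (k : ℝ) * Real.log 2) atTop atTop :=
    tendsto_natCast_atTop_atTop.atTop_mul_const hlog2
  have hbound : ∀ᶠ k : ℕ in atTop,
      μ.real {ω | (G (a (k * Real.log 2)) : EReal) < partialMax Y (2 ^ (k + 1)) ω} ≤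
        2 * D * (Real.log 2) ^ (-c) * (k : ℝ) ^ (-c) := by
    filter_upwards [(ha_top.comp hk_top).eventually hupp, eventually_gt_atTop 0] with k hk hk0
    have hk0' : (0 : ℝ) < k := by exact_mod_cast hk0
    refine (measureReal_lt_partialMax_le hid _ _).trans ?_
    refine (mul_le_mul_of_nonneg_left hk (Nat.cast_nonneg _)).trans (le_of_eq ?_)
    simp only [Function.comp, ha]
    have e1 : Real.exp (-(k * Real.log 2 + c * Real.log (k * Real.log 2))) =
        ((2 : ℝ) ^ k)⁻¹ * ((k : ℝ) ^ (-c) * (Real.log 2) ^ (-c)) := by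
      rw [← Real.mul_rpow hk0'.le hlog2.le, Real.rpow_def_of_pos (by positivity), neg_add,
        Real.exp_add, Real.exp_neg (k * Real.log 2), Real.exp_nat_mul, Real.exp_log two_pos]
      congr 2
      ring
    rw [e1]
    push_cast
    field_simp
    ring
  have hsum : Summable fun k : ℕ => 2 * D * (Real.log 2) ^ (-c) * (k : ℝ) ^ (-c) :=
    (Real.summable_nat_rpow.2 (by linarith)).mul_left _
  filter_upwards [ae_eventually_notMem_of_summable hsum hbound] with ω hω
  filter_upwards [tendsto_natLog_two.eventually hω,
    ((ha_top.comp hk_top).comp tendsto_natLog_two).eventually_ge_atTop b,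
    tendsto_natLog_two.eventually_gt_atTop 0, eventually_gt_atTop 0] with n h1 h2 h3 h4
  simp only [not_lt] at h1
  have h5 : n ≤ 2 ^ (Nat.log 2 n + 1) := (Nat.lt_pow_succ_log_self one_lt_two n).le
  refine (partialMax_mono Y ω h5).trans (h1.trans (EReal.coe_le_coe_iff.2 ?_))
  have h6 : (Nat.log 2 n : ℝ) * Real.log 2 ≤ Real.log n := by
    rw [← Real.log_pow]
    exact Real.log_le_log (by positivity) (by exact_mod_cast Nat.pow_log_le_self 2 h4.ne')
  have h7 : 0 < (Nat.log 2 n : ℝ) * Real.log 2 := by positivity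
  have h8 : a (Nat.log 2 n * Real.log 2) ≤ Real.log n + c * Real.log (Real.log n) := by
    simp only [ha]
    have := Real.log_le_log h7 h6
    have := mul_le_mul_of_nonneg_left this (show (0 : ℝ) ≤ c by linarith)
    linarith
  exact hb (Set.mem_Ici.2 h2) (Set.mem_Ici.2 (le_trans h2 h8)) h8

/-- Almost surely the partial maxima are infinitely often above `G (log n + log log n)`. -/
theorem ae_frequently_le_partialMax (hm : ∀ i, Measurable (Y i)) (hind : iIndepFun Y μ)
    (hid : ∀ i, IdentDistrib (Y i) (Y 0) μ μ) (hd : 0 < d)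
    (hlow : ∀ᶠ y in atTop, d * Real.exp (-y) ≤ μ.real {ω | (G y : EReal) < Y 0 ω}) :
    ∀ᵐ ω ∂μ, ∃ᶠ n : ℕ in atTop,
      (G (Real.log n + Real.log (Real.log n)) : EReal) ≤ partialMax Y (n + 1) ω := by
  set x : ℕ → EReal := fun n => (G (Real.log n + Real.log (Real.log n)) : EReal) with hx
  have hindep := iIndepFun.iIndepSet_biInter_preimage hm hind (J := fun k => {k})
    (fun k l hkl => Finset.disjoint_singleton.2 hkl) (A := fun k => Set.Ioi (x k))
    fun k => measurableSet_Ioi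
  simp only [Finset.mem_singleton, Set.iInter_iInter_eq_left] at hindep
  have htop : Tendsto (fun n : ℕ => Real.log n + Real.log (Real.log n)) atTop atTop := by
    have := (tendsto_add_mul_log zero_le_one).comp tendsto_log_natCast
    refine this.congr fun n => ?_
    simp only [Function.comp, one_mul]
  have hns : ¬ Summable fun n : ℕ => d * (1 / ((n : ℝ) * Real.log n)) := by
    rw [summable_mul_left_iff hd.ne']
    exact not_summable_one_div_natCast_mul_log
  have hae := ae_frequently_mem_of_not_summable (fun k => hm k measurableSet_Ioi) hindep hns
    (by
      filter_upwards [tendsto_log_natCast.eventually_gt_atTop 0] with n hn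
      positivity)
    (by
      filter_upwards [htop.eventually hlow, tendsto_log_natCast.eventually_gt_atTop 0,
        eventually_gt_atTop 0] with n hn hn1 hn0
      have hn0' : (0 : ℝ) < n := by exact_mod_cast hn0
      have h1 := measureReal_lt_eq hid n (G (Real.log n + Real.log (Real.log n)))
      rw [← h1] at hn
      refine le_trans (le_of_eq ?_) hn
      rw [neg_add, Real.exp_add, Real.exp_neg, Real.exp_neg, Real.exp_log hn0', Real.exp_log hn1]
      field_simp)
  filter_upwards [hae] with ω hω
  -- The term of index `n` is the last among the first `n + 1`.
  refine hω.mono fun n hn => ?_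
  exact (le_of_lt hn).trans (Finset.le_sup (f := fun i => Y i ω) (Finset.self_mem_range_succ n))

/-- Almost surely the partial maxima are eventually above `G (log n - c log log log n)`, `c > 1`. -/
theorem ae_eventually_le_partialMax (hm : ∀ i, Measurable (Y i)) (hind : iIndepFun Y μ)
    (hid : ∀ i, IdentDistrib (Y i) (Y 0) μ μ) (hG : ∃ b, MonotoneOn G (Set.Ici b)) (hd : 0 < d)
    (hlow : ∀ᶠ y in atTop, d * Real.exp (-y) ≤ μ.real {ω | (G y : EReal) < Y 0 ω})
    (hc : 1 < c) :
    ∀ᵐ ω ∂μ, ∀ᶠ n : ℕ in atTop,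
      (G (Real.log n - c * Real.log (Real.log (Real.log n))) : EReal) ≤ partialMax Y n ω := by
  obtain ⟨b, hb⟩ := hG
  have hlog2 : 0 < Real.log 2 := Real.log_pos one_lt_two
  -- This dominates the threshold on the whole block `2^k ≤ n < 2^(k+1)`: the main term is taken at
  -- the right endpoint, the subtracted one at the left.
  set a : ℕ → ℝ := fun k => (k + 1) * Real.log 2 - c * Real.log (Real.log (k * Real.log 2)) with ha
  have hk_top : Tendsto (fun k : ℕ => (k : ℝ) * Real.log 2) atTop atTop :=
    tendsto_natCast_atTop_atTop.atTop_mul_const hlog2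
  have ha_top : Tendsto a atTop atTop := by
    have := tendsto_atTop_add_const_right _ (Real.log 2) ((tendsto_sub_mul_log_log c).comp hk_top)
    refine this.congr fun k => ?_
    simp only [Function.comp, ha]
    ring
  have hw_top : Tendsto (fun k : ℕ => Real.log (k * Real.log 2)) atTop atTop :=
    Real.tendsto_log_atTop.comp hk_top
  have hbound : ∀ᶠ k : ℕ in atTop,
      μ.real {ω | partialMax Y (2 ^ k) ω ≤ (G (a k) : EReal)} ≤ (k : ℝ) ^ (-2 : ℝ) := by
    -- The exponent is `(d / 2) w^c` with `w = log (k log 2)`. Once `w^(c-1) ≥ 8 / d` it is at least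
    -- `4 w`, which exceeds `2 log k` when `log k ≥ -2 log (log 2)`.
    have hpow := ((tendsto_rpow_atTop (show 0 < c - 1 by linarith)).comp hw_top).eventually_ge_atTop
      (8 / d)
    filter_upwards [ha_top.eventually hlow, eventually_gt_atTop 0, hpow,
      hw_top.eventually_gt_atTop 0,
      tendsto_log_natCast.eventually_ge_atTop (-2 * Real.log (Real.log 2))] with k hk hk0 hp hw hl
    have hk0' : (0 : ℝ) < k := by exact_mod_cast hk0
    refine (measureReal_partialMax_le hm hind hid _ _).trans ?_
    rw [Real.rpow_def_of_pos hk0']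
    refine Real.exp_le_exp.2 ?_
    have h1 := mul_le_mul_of_nonneg_left hk (Nat.cast_nonneg (2 ^ k))
    have e1 : Real.exp (-a k) =
        (2 : ℝ)⁻¹ * ((2 : ℝ) ^ k)⁻¹ * (Real.log (k * Real.log 2)) ^ c := by
      rw [Real.rpow_def_of_pos hw]
      have : -a k = -Real.log 2 + -(k * Real.log 2) +
          Real.log (Real.log (k * Real.log 2)) * c := by
        simp only [ha]
        ring
      rw [this, Real.exp_add, Real.exp_add, Real.exp_neg, Real.exp_neg, Real.exp_nat_mul,
        Real.exp_log two_pos]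
    have e2 : ((2 ^ k : ℕ) : ℝ) * (d * Real.exp (-a k)) =
        d / 2 * (Real.log (k * Real.log 2)) ^ c := by
      rw [e1]
      push_cast
      field_simp
    have e3 : (Real.log (k * Real.log 2)) ^ c =
        (Real.log (k * Real.log 2)) ^ (c - 1) * Real.log (k * Real.log 2) := by
      rw [← Real.rpow_add_one hw.ne', sub_add_cancel]
    have h2 : 8 / d * Real.log (k * Real.log 2) ≤ (Real.log (k * Real.log 2)) ^ c := by
      rw [e3]
      exact mul_le_mul_of_nonneg_right hp hw.le
    have h3 : 4 * Real.log (k * Real.log 2) ≤ d / 2 * (Real.log (k * Real.log 2)) ^ c := by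
      refine le_trans (le_of_eq ?_) (mul_le_mul_of_nonneg_left h2 (by positivity))
      field_simp
      norm_num
    have h4 : Real.log (k * Real.log 2) = Real.log k + Real.log (Real.log 2) :=
      Real.log_mul hk0'.ne' hlog2.ne'
    rw [e2] at h1
    linarith
  have hsum : Summable fun k : ℕ => (k : ℝ) ^ (-2 : ℝ) := Real.summable_nat_rpow.2 (by norm_num)
  filter_upwards [ae_eventually_notMem_of_summable hsum hbound] with ω hω
  filter_upwards [tendsto_natLog_two.eventually hω, tendsto_natLog_two.eventually (hw_top.eventually_gt_atTop 0),
    ((tendsto_sub_mul_log_log c).comp tendsto_log_natCast).eventually_ge_atTop b,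
    tendsto_natLog_two.eventually_gt_atTop 0, eventually_gt_atTop 0] with n h1 hw h2 h3 h4
  simp only [not_le] at h1
  have h5 : 2 ^ Nat.log 2 n ≤ n := Nat.pow_log_le_self 2 h4.ne'
  refine le_trans (EReal.coe_le_coe_iff.2 ?_) (h1.le.trans (partialMax_mono Y ω h5))
  have h6 : (Nat.log 2 n : ℝ) * Real.log 2 ≤ Real.log n := by
    rw [← Real.log_pow]
    exact Real.log_le_log (by positivity) (by exact_mod_cast h5)
  have h6' : Real.log n ≤ ((Nat.log 2 n : ℝ) + 1) * Real.log 2 := by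
    have h7 : n ≤ 2 ^ (Nat.log 2 n + 1) := (Nat.lt_pow_succ_log_self one_lt_two n).le
    have h8 : Real.log n ≤ Real.log ((2 : ℝ) ^ (Nat.log 2 n + 1)) :=
      Real.log_le_log (by exact_mod_cast h4) (by exact_mod_cast h7)
    rw [Real.log_pow] at h8
    exact_mod_cast h8
  have h7 : 0 < (Nat.log 2 n : ℝ) * Real.log 2 := by positivity
  have h8 : Real.log n - c * Real.log (Real.log (Real.log n)) ≤ a (Nat.log 2 n) := by
    simp only [ha]
    have := Real.log_le_log hw (Real.log_le_log h7 h6)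
    have := mul_le_mul_of_nonneg_left this (show (0 : ℝ) ≤ c by linarith)
    linarith
  exact hb (Set.mem_Ici.2 h2) (Set.mem_Ici.2 (le_trans h2 h8)) h8

/-- Almost surely the partial maxima are infinitely often below `G (log n - c log log log n)`,
`0 < c < 1`. -/
theorem ae_frequently_partialMax_le (hm : ∀ i, Measurable (Y i)) (hind : iIndepFun Y μ)
    (hid : ∀ i, IdentDistrib (Y i) (Y 0) μ μ) (hG : ∃ b, MonotoneOn G (Set.Ici b)) (hD : 0 < D)
    (hupp : ∀ᶠ y in atTop, μ.real {ω | (G y : EReal) < Y 0 ω} ≤ D * Real.exp (-y))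
    (hc0 : 0 < c) (hc : c < 1) :
    ∀ᵐ ω ∂μ, ∃ᶠ n : ℕ in atTop,
      partialMax Y n ω ≤ (G (Real.log n - c * Real.log (Real.log (Real.log n))) : EReal) := by
  have hearly := ae_eventually_partialMax_le (c := 2) hid hG hupp one_lt_two
  obtain ⟨b, hb⟩ := hG
  have hlog2 : 0 < Real.log 2 := Real.log_pos one_lt_two
  have hloglog2 : Real.log (Real.log 2) < 0 :=
    Real.log_neg hlog2 (by linarith [Real.log_two_lt_d9])
  -- With `2^(k^2)`, the terms before `N k` are negligible against the threshold at `N (k + 1)`,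
  -- while `log log (N k)` still grows only like `2 log k`, so the block probabilities are not
  -- summable.
  set N : ℕ → ℕ := fun k => 2 ^ k ^ 2 with hN
  have hN_mono : StrictMono N := fun k l hkl =>
    Nat.pow_lt_pow_right one_lt_two (Nat.pow_lt_pow_left hkl two_ne_zero)
  have hN_top : Tendsto N atTop atTop := hN_mono.tendsto_atTop
  have hNlog : ∀ k, Real.log (N k) = (k : ℝ) ^ 2 * Real.log 2 := fun k => by
    simp only [hN]
    push_cast
    rw [Real.log_pow]
    push_cast
    rfl
  have hNloglog : ∀ k, 0 < k →
      Real.log (Real.log (N k)) = 2 * Real.log k + Real.log (Real.log 2) := fun k hk => by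
    have : (0 : ℝ) < k := by exact_mod_cast hk
    rw [hNlog, Real.log_mul (by positivity) hlog2.ne', Real.log_pow]
    push_cast
    rfl
  set a : ℕ → ℝ := fun k =>
    Real.log (N (k + 1)) - c * Real.log (Real.log (Real.log (N (k + 1)))) with ha
  have hN1_top : Tendsto (fun k => (N (k + 1) : ℝ)) atTop atTop :=
    tendsto_natCast_atTop_atTop.comp (hN_top.comp (tendsto_add_atTop_nat 1))
  have ha_top : Tendsto a atTop atTop :=
    (tendsto_sub_mul_log_log c).comp (Real.tendsto_log_atTop.comp hN1_top)
  have hw_top : Tendsto (fun k => Real.log (Real.log (N (k + 1)))) atTop atTop :=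
    tendsto_log_log.comp hN1_top
  set B : ℕ → Set Ω := fun k =>
    ⋂ i ∈ Finset.Ico (N k) (N (k + 1)), Y i ⁻¹' Set.Iic (G (a k) : EReal) with hB
  have hindep : iIndepSet B μ := by
    refine iIndepFun.iIndepSet_biInter_preimage hm hind (fun k l hkl => ?_)
      fun k => measurableSet_Iic
    refine Finset.disjoint_left.2 fun i hi hi' => ?_
    rw [Finset.mem_Ico] at hi hi'
    rcases lt_or_gt_of_ne hkl with h | h
    · have := hN_mono.monotone (Nat.succ_le_of_lt h)
      simp only [Nat.succ_eq_add_one] at this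
      omega
    · have := hN_mono.monotone (Nat.succ_le_of_lt h)
      simp only [Nat.succ_eq_add_one] at this
      omega
  have hBm : ∀ k, MeasurableSet (B k) := fun k =>
    Finset.measurableSet_biInter _ fun i _ => hm i measurableSet_Iic
  have hns : ¬ Summable fun k : ℕ => 1 / ((k + 1 : ℕ) : ℝ) := by
    rw [summable_nat_add_iff 1 (f := fun k : ℕ => 1 / (k : ℝ))]
    exact Real.not_summable_one_div_natCast
  have hbound : ∀ᶠ k : ℕ in atTop, 1 / ((k + 1 : ℕ) : ℝ) ≤ μ.real (B k) := by
    -- Here `c < 1` enters: with `w = log log (N (k + 1))`, the expected number of exceedances is at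
    -- most `D w^c ≤ w / 4`.
    have hpow : ∀ᶠ k : ℕ in atTop,
        (Real.log (Real.log (N (k + 1)))) ^ (c - 1) < 1 / (4 * D) := by
      have := (tendsto_rpow_neg_atTop (show 0 < 1 - c by linarith)).comp hw_top
      rw [neg_sub] at this
      exact this.eventually (gt_mem_nhds (by positivity))
    have hq : ∀ᶠ k : ℕ in atTop, D * Real.exp (-a k) ≤ 1 / 2 := by
      have := (Real.tendsto_exp_neg_atTop_nhds_zero.comp ha_top).const_mul D
      rw [mul_zero] at this
      exact (this.eventually (gt_mem_nhds (by norm_num : (0 : ℝ) < 1 / 2))).mono fun k hk => hk.le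
    filter_upwards [ha_top.eventually hupp, hpow, hq, hw_top.eventually_gt_atTop 0] with
      k hk hp hq hw
    rw [measureReal_biInter_le hm hind hid]
    set q := μ.real {ω | (G (a k) : EReal) < Y 0 ω}
    have hq0 : 0 ≤ q := measureReal_nonneg
    have hq2 : q ≤ 1 / 2 := hk.trans hq
    set w := Real.log (Real.log (N (k + 1))) with hw_def
    have hNpos : (0 : ℝ) < N (k + 1) := by simp only [hN]; positivity
    have e1 : (N (k + 1) : ℝ) * Real.exp (-a k) = w ^ c := by
      rw [Real.rpow_def_of_pos hw]
      have : -a k = -Real.log (N (k + 1)) + Real.log w * c := by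
        simp only [ha, hw_def]
        ring
      rw [this, Real.exp_add, Real.exp_neg, Real.exp_log hNpos]
      field_simp
    have e2 : w ^ c = w ^ (c - 1) * w := by rw [← Real.rpow_add_one hw.ne', sub_add_cancel]
    have h1 : N (k + 1) * q ≤ w / 4 := by
      have h2 := mul_le_mul_of_nonneg_left hk hNpos.le
      have h3 := mul_le_mul_of_nonneg_right hp.le hw.le
      rw [← e2] at h3
      have h4 := mul_le_mul_of_nonneg_left h3 hD.le
      have e4 : D * (1 / (4 * D) * w) = w / 4 := by field_simp
      have e5 : (N (k + 1) : ℝ) * (D * Real.exp (-a k)) = D * w ^ c := by rw [← e1]; ring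
      linarith
    have h2 : w ≤ 2 * Real.log ((k + 1 : ℕ) : ℝ) := by
      rw [hw_def, hNloglog (k + 1) k.succ_pos]
      linarith
    -- For `0 ≤ q ≤ 1/2`, `1 / (1 - q) ≤ 1 + 2 q ≤ exp (2 q)`.
    have hexp : Real.exp (-(2 * q)) ≤ 1 - q := by
      have h5 := Real.add_one_le_exp (2 * q)
      rw [Real.exp_neg]
      refine inv_le_of_inv_le₀ (by linarith) ?_
      refine le_trans ?_ h5
      rw [inv_le_iff_one_le_mul₀ (by linarith)]
      nlinarith
    have hk1 : (0 : ℝ) < ((k + 1 : ℕ) : ℝ) := by positivity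
    calc 1 / ((k + 1 : ℕ) : ℝ) = Real.exp (-Real.log ((k + 1 : ℕ) : ℝ)) := by
          rw [Real.exp_neg, Real.exp_log hk1, one_div]
      _ ≤ Real.exp (N (k + 1) * -(2 * q)) := Real.exp_le_exp.2 (by linarith)
      _ = (Real.exp (-(2 * q))) ^ N (k + 1) := Real.exp_nat_mul _ _
      _ ≤ (1 - q) ^ N (k + 1) := pow_le_pow_left₀ (Real.exp_pos _).le hexp _
      _ ≤ (1 - q) ^ (Finset.Ico (N k) (N (k + 1))).card :=
          pow_le_pow_of_le_one (by linarith) (by linarith)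
            (by rw [Nat.card_Ico]; exact Nat.sub_le _ _)
  have hae := ae_frequently_mem_of_not_summable hBm hindep hns
    (Eventually.of_forall fun k => by positivity) hbound
  -- The gap `(2 k + 1) log 2` between the logarithms of `N k` and `N (k + 1)` absorbs at most `6
  -- log (k + 1)` of corrections; hence the constant `log 2 / 6`.
  have hgap : ∀ᶠ k : ℕ in atTop, Real.log (N k) + 2 * Real.log (Real.log (N k)) ≤ a k := by
    have hlog := (tendsto_log_div_id.comp ((tendsto_natCast_atTop_atTop (R := ℝ)).comp
      (tendsto_add_atTop_nat 1))).eventually (gt_mem_nhds (show 0 < Real.log 2 / 6 by positivity))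
    filter_upwards [hlog, eventually_gt_atTop 0, hw_top.eventually_gt_atTop 0] with k hk hk0 hw
    have hk0' : (0 : ℝ) < k := by exact_mod_cast hk0
    simp only [Function.comp] at hk
    rw [div_lt_iff₀ (by positivity)] at hk
    have h1 : Real.log (Real.log (Real.log (N (k + 1)))) ≤ Real.log (Real.log (N (k + 1))) :=
      (Real.log_le_sub_one_of_pos hw).trans (by linarith)
    have h1' : c * Real.log (Real.log (Real.log (N (k + 1)))) ≤ Real.log (Real.log (N (k + 1))) :=
      (mul_le_mul_of_nonneg_left h1 hc0.le).trans (mul_le_of_le_one_left hw.le hc.le)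
    have h5 := hNloglog (k + 1) k.succ_pos
    have h6 := hNlog (k + 1)
    have h2 : Real.log k ≤ Real.log ((k + 1 : ℕ) : ℝ) :=
      Real.log_le_log hk0' (by push_cast; linarith)
    simp only [ha]
    rw [hNloglog k hk0, hNlog k]
    push_cast at h5 h6 h2 hk
    nlinarith
  have hbd : ∀ᶠ k : ℕ in atTop, b ≤ Real.log (N k) + 2 * Real.log (Real.log (N k)) :=
    (((tendsto_add_mul_log zero_le_two).comp tendsto_log_natCast).comp hN_top).eventually_ge_atTop b
  filter_upwards [hae, hearly] with ω hω hω'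
  have hfreq : ∃ᶠ k in atTop, partialMax Y (N (k + 1)) ω ≤ (G (a k) : EReal) := by
    refine (hω.and_eventually ((hN_top.eventually hω').and (hgap.and hbd))).mono ?_
    rintro k ⟨h1, h2, h3, h4⟩
    refine Finset.sup_le fun i hi => ?_
    rw [Finset.mem_range] at hi
    rcases lt_or_ge i (N k) with h | h
    · refine (Finset.le_sup (f := fun i => Y i ω) (Finset.mem_range.2 h)).trans (h2.trans ?_)
      exact EReal.coe_le_coe_iff.2 (hb (Set.mem_Ici.2 h4) (Set.mem_Ici.2 (h4.trans h3)) h3)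
    · exact Set.mem_iInter₂.1 h1 i (Finset.mem_Ico.2 ⟨h, hi⟩)
  exact (hN_top.comp (tendsto_add_atTop_nat 1)).frequently hfreq

end Maxima

/-! ### Logarithmic scales and the normalized increment. -/

theorem tendsto_div_of_tendsto_sub {ι : Type*} {l : Filter ι} {a b : ι → ℝ} {r : ℝ}
    (ha : Tendsto a l atTop) (h : Tendsto (fun i => b i - a i) l (𝓝 r)) :
    Tendsto (fun i => b i / a i) l (𝓝 1) := by
  have h1 := (h.div_atTop ha).const_add 1
  rw [add_zero] at h1
  refine h1.congr' ?_
  filter_upwards [ha.eventually_gt_atTop 0] with i hi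
  field_simp
  ring

theorem tendsto_atTop_of_tendsto_div {ι : Type*} {l : Filter ι} {a b : ι → ℝ}
    (ha : Tendsto a l atTop) (h : Tendsto (fun i => b i / a i) l (𝓝 1)) : Tendsto b l atTop := by
  refine (ha.atTop_mul_pos one_pos h).congr' ?_
  filter_upwards [ha.eventually_gt_atTop 0] with i hi
  field_simp

theorem tendsto_log_div_log {ι : Type*} {l : Filter ι} {a b : ι → ℝ}
    (ha : Tendsto a l atTop) (h : Tendsto (fun i => b i / a i) l (𝓝 1)) :
    Tendsto (fun i => Real.log (b i) / Real.log (a i)) l (𝓝 1) := by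
  have hb := tendsto_atTop_of_tendsto_div ha h
  refine tendsto_div_of_tendsto_sub (r := 0) (Real.tendsto_log_atTop.comp ha) ?_
  have h1 := h.log one_ne_zero
  rw [Real.log_one] at h1
  refine h1.congr' ?_
  filter_upwards [ha.eventually_gt_atTop 0, hb.eventually_gt_atTop 0] with i h2 h3
  exact Real.log_div h3.ne' h2.ne'

theorem tendsto_log_log_div_log_log {ι : Type*} {l : Filter ι} {a b : ι → ℝ}
    (ha : Tendsto a l atTop) (h : Tendsto (fun i => b i / a i) l (𝓝 1)) :
    Tendsto (fun i => Real.log (Real.log (b i)) / Real.log (Real.log (a i))) l (𝓝 1) :=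
  tendsto_log_div_log (Real.tendsto_log_atTop.comp ha) (tendsto_log_div_log ha h)

/-- The properties shared by the logarithm and the iterated logarithm as scaling functions. -/
structure LogarithmicScale (ψ : ℝ → ℝ) : Prop where
  tendsto_atTop : Tendsto ψ atTop atTop
  tendsto_div_id : Tendsto (fun s => ψ s / s) atTop (𝓝 0)
  tendsto_div : ∀ {ι : Type} {l : Filter ι} {a b : ι → ℝ}, Tendsto a l atTop →
    Tendsto (fun i => b i / a i) l (𝓝 1) → Tendsto (fun i => ψ (b i) / ψ (a i)) l (𝓝 1)

theorem logarithmicScale_log : LogarithmicScale Real.log :=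
  ⟨Real.tendsto_log_atTop, tendsto_log_div_id, tendsto_log_div_log⟩

theorem logarithmicScale_log_log : LogarithmicScale fun s => Real.log (Real.log s) :=
  ⟨tendsto_log_log, tendsto_log_log_div_id, tendsto_log_log_div_log_log⟩

/-- The normalized distance between `G (log n + c ψ (log n))` and `G (log (t / α))` when `t ∼ α n`
and `ψ` is a logarithmic scale. -/
theorem RegularlyVarying.tendsto_normalized {U G : ℝ → ℝ} {κ : ℝ} (hU : RegularlyVarying U κ)
    (hG : ∀ᶠ y in atTop, HasDerivAt G (U y) y) {ι : Type} {l : Filter ι} {n : ι → ℕ}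
    {t : ι → ℝ≥0} {α c : ℝ} (hα : 0 < α) (hn : Tendsto n l atTop)
    (ht : Tendsto (fun i => (t i : ℝ) / n i) l (𝓝 α)) {ψ : ℝ → ℝ} (hψ : LogarithmicScale ψ) :
    Tendsto (fun i => (G (Real.log (n i) + c * ψ (Real.log (n i))) - G (Real.log ((t i : ℝ) / α))) /
      U (Real.log ((t i : ℝ) / α)) / ψ (Real.log (t i))) l (𝓝 c) := by
  have hnr : Tendsto (fun i => (n i : ℝ)) l atTop := tendsto_natCast_atTop_atTop.comp hn
  have hp : Tendsto (fun i => Real.log (n i)) l atTop := Real.tendsto_log_atTop.comp hnr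
  have htt : Tendsto (fun i => (t i : ℝ)) l atTop := by
    refine (hnr.atTop_mul_pos hα ht).congr' ?_
    filter_upwards [hnr.eventually_gt_atTop 0] with i hi
    field_simp
  have hty : Tendsto (fun i => Real.log ((t i : ℝ) / α)) l atTop :=
    Real.tendsto_log_atTop.comp (htt.atTop_div_const hα)
  have hq : Tendsto (fun i => Real.log (t i)) l atTop := Real.tendsto_log_atTop.comp htt
  have hδ : Tendsto (fun i => Real.log ((t i : ℝ) / α) - Real.log (n i)) l (𝓝 0) := by
    have h1 := (ht.div_const α).log (by rw [div_self hα.ne']; exact one_ne_zero)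
    rw [div_self hα.ne', Real.log_one] at h1
    refine h1.congr' ?_
    filter_upwards [hnr.eventually_gt_atTop 0, htt.eventually_gt_atTop 0] with i h2 h3
    rw [← Real.log_div (by positivity) h2.ne', div_right_comm]
  have hyp : Tendsto (fun i => Real.log ((t i : ℝ) / α) / Real.log (n i)) l (𝓝 1) :=
    tendsto_div_of_tendsto_sub hp hδ
  have hpq : Tendsto (fun i => Real.log (n i) / Real.log (t i)) l (𝓝 1) := by
    refine tendsto_div_of_tendsto_sub (r := -Real.log α) hq ?_
    have h1 := (hδ.add_const (Real.log α)).neg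
    rw [zero_add] at h1
    refine h1.congr' ?_
    filter_upwards [htt.eventually_gt_atTop 0] with i h3
    rw [Real.log_div h3.ne' hα.ne']
    ring
  have hψp : Tendsto (fun i => ψ (Real.log (n i)) / Real.log (n i)) l (𝓝 0) := hψ.tendsto_div_id.comp hp
  refine hU.tendsto_sub_div hG hty ?_ ?_
  · have h1 := (((hψp.const_mul c).const_add 1).div hyp one_ne_zero).sub_const 1
    rw [mul_zero, add_zero, div_one, sub_self] at h1
    refine h1.congr' ?_
    filter_upwards [hp.eventually_gt_atTop 0, hty.eventually_gt_atTop 0] with i h2 h3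
    simp only [Pi.div_apply]
    field_simp
  · have h1 := (hδ.neg.div_atTop (hψ.tendsto_atTop.comp hq)).add ((hψ.tendsto_div hq hpq).const_mul c)
    rw [mul_one, zero_add] at h1
    refine h1.congr fun i => ?_
    simp only [Function.comp]
    ring

/-! ### Upper and lower limits in the extended reals. -/

section ERealLimits

variable {u : ℝ≥0 → EReal} {c : ℝ}

theorem limsup_le_of_eventually_le_coe {v : ℝ≥0 → ℝ} (hv : Tendsto v atTop (𝓝 c))
    (h : ∀ᶠ t in atTop, u t ≤ (v t : EReal)) : limsup u atTop ≤ (c : EReal) :=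
  (limsup_le_limsup h).trans ((continuous_coe_real_ereal.tendsto c).comp hv).limsup_eq.le

theorem le_liminf_of_eventually_coe_le {v : ℝ≥0 → ℝ} (hv : Tendsto v atTop (𝓝 c))
    (h : ∀ᶠ t in atTop, (v t : EReal) ≤ u t) : (c : EReal) ≤ liminf u atTop :=
  ((continuous_coe_real_ereal.tendsto c).comp hv).liminf_eq.ge.trans (liminf_le_liminf h)

theorem le_limsup_of_frequently_coe_le {τ : ℕ → ℝ≥0} {v : ℕ → ℝ} (hτ : Tendsto τ atTop atTop)
    (hv : Tendsto v atTop (𝓝 c)) (h : ∃ᶠ n in atTop, (v n : EReal) ≤ u (τ n)) :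
    (c : EReal) ≤ limsup u atTop := by
  refine le_of_forall_lt fun b hb => ?_
  obtain ⟨b', hbb', hb'⟩ := exists_between hb
  have h1 := ((continuous_coe_real_ereal.tendsto c).comp hv).eventually (lt_mem_nhds hb')
  refine hbb'.trans_le (le_limsup_of_frequently_le (hτ.frequently ?_))
  exact (h.and_eventually h1).mono fun n hn => hn.2.le.trans hn.1

theorem liminf_le_of_frequently_le_coe {τ : ℕ → ℝ≥0} {v : ℕ → ℝ} (hτ : Tendsto τ atTop atTop)
    (hv : Tendsto v atTop (𝓝 c)) (h : ∃ᶠ n in atTop, u (τ n) ≤ (v n : EReal)) :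
    liminf u atTop ≤ (c : EReal) := by
  refine le_of_forall_gt fun b hb => ?_
  obtain ⟨b', hb', hbb'⟩ := exists_between hb
  have h1 := ((continuous_coe_real_ereal.tendsto c).comp hv).eventually (gt_mem_nhds hb')
  refine (liminf_le_of_frequently_le (hτ.frequently ?_)).trans_lt hbb'
  exact (h.and_eventually h1).mono fun n hn => hn.1.trans hn.2.le

/-- The factor `r` is written as division by `1 / r` to match `U = 1 / r` in
`RegularlyVarying.tendsto_normalized`; with `1 / 0 = 0` this is also correct for `r = 0`. -/
theorem coe_mul_sub_div_le {r A L g : ℝ} {m : EReal} (hr : 0 ≤ r) (hL : 0 ≤ L)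
    (h : m ≤ (g : EReal)) :
    (r : EReal) * (m - (A : EReal)) / (L : EReal) ≤ (((g - A) / (1 / r) / L : ℝ) : EReal) := by
  have e : (((g - A) / (1 / r) / L : ℝ) : EReal) =
      (r : EReal) * ((g : EReal) - (A : EReal)) / (L : EReal) := by
    rw [← EReal.coe_sub, ← EReal.coe_mul, ← EReal.coe_div]
    congr 2
    rw [div_div_eq_mul_div, div_one, mul_comm]
  rw [e]
  exact EReal.div_le_div_right_of_nonneg (EReal.coe_nonneg.2 hL)
    (mul_le_mul_of_nonneg_left (EReal.sub_le_sub h le_rfl) (EReal.coe_nonneg.2 hr))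

theorem le_coe_mul_sub_div {r A L g : ℝ} {m : EReal} (hr : 0 ≤ r) (hL : 0 ≤ L)
    (h : (g : EReal) ≤ m) :
    (((g - A) / (1 / r) / L : ℝ) : EReal) ≤ (r : EReal) * (m - (A : EReal)) / (L : EReal) := by
  have e : (((g - A) / (1 / r) / L : ℝ) : EReal) =
      (r : EReal) * ((g : EReal) - (A : EReal)) / (L : EReal) := by
    rw [← EReal.coe_sub, ← EReal.coe_mul, ← EReal.coe_div]
    congr 2
    rw [div_div_eq_mul_div, div_one, mul_comm]
  rw [e]
  exact EReal.div_le_div_right_of_nonneg (EReal.coe_nonneg.2 hL)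
    (mul_le_mul_of_nonneg_left (EReal.sub_le_sub h le_rfl) (EReal.coe_nonneg.2 hr))

end ERealLimits

/-! ### Renewal counting and maxima at regeneration epochs. -/

section Renewal

/-- The index of the renewal period `[S n, S (n + 1))` containing `t`. -/
theorem exists_renewal_index {S : ℕ → ℝ≥0} (h0 : S 0 = 0) {t : ℝ≥0} {n : ℕ} (hn : t < S n) :
    ∃ i < n, S i ≤ t ∧ t < S (i + 1) := by
  classical
  have hex : ∃ n, t < S n := ⟨n, hn⟩
  have hpos : Nat.find hex ≠ 0 := fun h => by
    have := Nat.find_spec hex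
    rw [h, h0] at this
    exact not_lt_bot this
  obtain ⟨i, hi⟩ := Nat.exists_eq_succ_of_ne_zero hpos
  have hle : i.succ ≤ n := hi ▸ Nat.find_min' hex hn
  refine ⟨i, hle, not_lt.1 (Nat.find_min hex (by omega)), ?_⟩
  have := Nat.find_spec hex
  rwa [hi] at this

/-- Sandwich `t` between consecutive epochs. Both ratios are recorded because lower bounds use the
completed cycles and upper bounds also the current one. -/
theorem exists_renewal_count {S : ℕ → ℝ≥0} (h0 : S 0 = 0) (hS : Monotone S) {α : ℝ} (hα : 0 < α)
    (hlim : Tendsto (fun n : ℕ => (S n : ℝ) / n) atTop (𝓝 α)) :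
    ∃ N : ℝ≥0 → ℕ, (∀ t, S (N t) ≤ t ∧ t < S (N t + 1)) ∧ Tendsto N atTop atTop ∧
      Tendsto (fun t : ℝ≥0 => (t : ℝ) / N t) atTop (𝓝 α) ∧
      Tendsto (fun t : ℝ≥0 => (t : ℝ) / (N t + 1 : ℕ)) atTop (𝓝 α) := by
  have hStop : Tendsto S atTop atTop := by
    rw [← NNReal.tendsto_coe_atTop]
    refine (tendsto_natCast_atTop_atTop.atTop_mul_pos hα hlim).congr' ?_
    filter_upwards [eventually_gt_atTop 0] with n hn
    have : (n : ℝ) ≠ 0 := by positivity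
    field_simp
  have hex : ∀ t, ∃ i, S i ≤ t ∧ t < S (i + 1) := fun t => by
    obtain ⟨n, hn⟩ := (hStop.eventually_gt_atTop t).exists
    obtain ⟨i, -, hi⟩ := exists_renewal_index h0 hn
    exact ⟨i, hi⟩
  choose N hN using hex
  have hNtop : Tendsto N atTop atTop := by
    refine tendsto_atTop.2 fun k => ?_
    filter_upwards [eventually_ge_atTop (S k)] with t ht
    by_contra! hlt
    exact absurd ((hN t).2.trans_le (hS (Nat.succ_le_of_lt hlt))) (not_lt.2 ht)
  have hN1top : Tendsto (fun t => N t + 1) atTop atTop := (tendsto_add_atTop_nat 1).comp hNtop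
  have hratio : Tendsto (fun t : ℝ≥0 => ((N t + 1 : ℕ) : ℝ) / N t) atTop (𝓝 1) := by
    refine tendsto_div_of_tendsto_sub (r := 1) (tendsto_natCast_atTop_atTop.comp hNtop) ?_
    refine tendsto_const_nhds.congr fun t => ?_
    simp
  have hlow := hlim.comp hNtop
  have hupp := (hlim.comp hN1top).mul hratio
  rw [mul_one] at hupp
  have h1 : Tendsto (fun t : ℝ≥0 => (t : ℝ) / N t) atTop (𝓝 α) := by
    refine tendsto_of_tendsto_of_tendsto_of_le_of_le' hlow hupp ?_ ?_
    · exact Eventually.of_forall fun t => div_le_div_of_nonneg_right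
        (NNReal.coe_le_coe.2 (hN t).1) (Nat.cast_nonneg _)
    · filter_upwards [hNtop.eventually_gt_atTop 0] with t ht
      have h2 : (0 : ℝ) < N t := by exact_mod_cast ht
      have h3 : ((N t + 1 : ℕ) : ℝ) ≠ 0 := by positivity
      simp only [Function.comp]
      rw [div_mul_div_cancel₀ h3]
      exact div_le_div_of_nonneg_right (NNReal.coe_le_coe.2 (hN t).2.le) h2.le
  refine ⟨N, hN, hNtop, h1, ?_⟩
  have h2 := h1.div hratio one_ne_zero
  rw [div_one] at h2
  refine h2.congr' ?_
  filter_upwards [hNtop.eventually_gt_atTop 0] with t ht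
  have h2 : (0 : ℝ) < N t := by exact_mod_cast ht
  simp only [Pi.div_apply]
  field_simp

variable {Ω : Type*}

theorem epoch_succ (T : ℕ → Ω → ℝ≥0) (k : ℕ) (ω : Ω) :
    epoch T (k + 1) ω = epoch T k ω + T k ω :=
  Finset.sum_range_succ _ _

theorem epoch_mono (T : ℕ → Ω → ℝ≥0) (ω : Ω) : Monotone fun k => epoch T k ω :=
  monotone_nat_of_le_succ fun k => by
    rw [epoch_succ]
    exact le_self_add

theorem runningMax_mono (X : ℝ≥0 → Ω → ℝ) (ω : Ω) : Monotone fun t => runningMax X t ω :=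
  fun _ _ h => iSup_le fun s => le_iSup_of_le ⟨s.1, s.2.trans_le h⟩ le_rfl

/-- The first `n` cycles partition `[0, S n)`, so the supremum splits into cycle suprema;
measurability plays no role. -/
theorem runningMax_epoch {E : Type*} [FunLike E ℝ≥0 ℝ] {T : ℕ → Ω → ℝ≥0} {ξ : ℕ → Ω → E}
    {X : ℝ≥0 → Ω → ℝ} {ω : Ω}
    (h : ∀ k : ℕ, ∀ t ∈ Set.Ico (epoch T k ω) (epoch T (k + 1) ω), X t ω = ξ k ω (t - epoch T k ω))
    (n : ℕ) : runningMax X (epoch T n ω) ω =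
      partialMax (fun i ω => pathSup (fun s => ξ i ω s) (T i ω)) n ω := by
  apply le_antisymm
  · refine iSup_le fun ⟨s, hs⟩ => ?_
    obtain ⟨i, hin, h1, h2⟩ := exists_renewal_index (S := fun k => epoch T k ω)
      (by simp [epoch]) (Set.mem_Iio.1 hs)
    refine le_trans ?_ (Finset.le_sup
      (f := fun i => pathSup (fun s => ξ i ω s) (T i ω)) (Finset.mem_range.2 hin))
    have hlt : s - epoch T i ω < T i ω := by
      rw [epoch_succ] at h2
      exact tsub_lt_iff_left h1 |>.2 h2
    simp only [h i s ⟨h1, h2⟩]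
    exact le_iSup (fun r : Set.Iio (T i ω) => ((ξ i ω r : ℝ) : EReal)) ⟨_, hlt⟩
  · refine Finset.sup_le fun i hi => iSup_le fun ⟨s, hs⟩ => ?_
    have hs' : epoch T i ω + s < epoch T (i + 1) ω := by
      rw [epoch_succ]
      exact add_lt_add_right (Set.mem_Iio.1 hs) _
    have hlt : epoch T i ω + s < epoch T n ω :=
      hs'.trans_le (epoch_mono T ω (Nat.succ_le_of_lt (Finset.mem_range.1 hi)))
    have hX := h i (epoch T i ω + s) ⟨le_self_add, hs'⟩
    rw [add_tsub_cancel_left] at hX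
    refine le_trans (le_of_eq ?_)
      (le_iSup (fun r : Set.Iio (epoch T n ω) => ((X r ω : ℝ) : EReal)) ⟨_, hlt⟩)
    simp only [hX]

end Renewal

/-! ### From cycles to continuous time. -/

/-- Transfer of bounds on the partial maxima over cycles to the running maximum in continuous
time, along a path whose regeneration epochs obey the law of large numbers. -/
theorem normalizedMax_bounds {Ω : Type*} {T : ℕ → Ω → ℝ≥0} {X : ℝ≥0 → Ω → ℝ} {ω : Ω} {R₀ : ℝ → ℝ}
    {κ α c : ℝ} {m : ℕ → EReal} {ψ : ℝ → ℝ}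
    (hU : RegularlyVarying (fun y : ℝ => 1 / deriv R₀ (genInv R₀ y)) κ)
    (hG : ∀ᶠ y in atTop, HasDerivAt (genInv R₀) (1 / deriv R₀ (genInv R₀ y)) y) (hα : 0 < α)
    (hlim : Tendsto (fun n : ℕ => (epoch T n ω : ℝ) / n) atTop (𝓝 α))
    (hm : ∀ n, runningMax X (epoch T n ω) ω = m n) (hψ : LogarithmicScale ψ) :
    ((∀ᶠ n : ℕ in atTop, m n ≤ (genInv R₀ (Real.log n + c * ψ (Real.log n)) : EReal)) →
      limsup (fun t : ℝ≥0 => normalizedMax R₀ α X t ω / ((ψ (Real.log t) : ℝ) : EReal)) atTop ≤ c) ∧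
    ((∀ᶠ n : ℕ in atTop, (genInv R₀ (Real.log n + c * ψ (Real.log n)) : EReal) ≤ m n) →
      c ≤ liminf (fun t : ℝ≥0 => normalizedMax R₀ α X t ω / ((ψ (Real.log t) : ℝ) : EReal)) atTop) ∧
    ((∃ᶠ n : ℕ in atTop, (genInv R₀ (Real.log n + c * ψ (Real.log n)) : EReal) ≤ m (n + 1)) →
      c ≤ limsup (fun t : ℝ≥0 => normalizedMax R₀ α X t ω / ((ψ (Real.log t) : ℝ) : EReal)) atTop) ∧
    ((∃ᶠ n : ℕ in atTop, m n ≤ (genInv R₀ (Real.log n + c * ψ (Real.log n)) : EReal)) →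
      liminf (fun t : ℝ≥0 => normalizedMax R₀ α X t ω / ((ψ (Real.log t) : ℝ) : EReal)) atTop ≤ c) := by
  obtain ⟨N, hN, hNtop, hN0, hN1⟩ :=
    exists_renewal_count (S := fun n => epoch T n ω) (by simp [epoch]) (epoch_mono T ω) hα hlim
  have hN1top : Tendsto (fun t => N t + 1) atTop atTop := (tendsto_add_atTop_nat 1).comp hNtop
  have hStop : Tendsto (fun n => epoch T n ω) atTop atTop := by
    rw [← NNReal.tendsto_coe_atTop]
    refine (tendsto_natCast_atTop_atTop.atTop_mul_pos hα hlim).congr' ?_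
    filter_upwards [eventually_gt_atTop 0] with n hn
    have : (n : ℝ) ≠ 0 := by positivity
    field_simp
  have hr : ∀ᶠ t : ℝ≥0 in atTop, 0 ≤ deriv R₀ (centering R₀ α t) := by
    have : Tendsto (fun t : ℝ≥0 => Real.log ((t : ℝ) / α)) atTop atTop :=
      Real.tendsto_log_atTop.comp ((NNReal.tendsto_coe_atTop.2 tendsto_id).atTop_div_const hα)
    filter_upwards [this.eventually hU.eventually_pos] with t ht
    exact (one_div_pos.1 ht).le
  have hL : ∀ᶠ t : ℝ≥0 in atTop, 0 ≤ ψ (Real.log t) :=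
    ((hψ.tendsto_atTop.comp Real.tendsto_log_atTop).comp
      (NNReal.tendsto_coe_atTop.2 tendsto_id)).eventually_ge_atTop 0
  have hS1top : Tendsto (fun n => epoch T (n + 1) ω) atTop atTop :=
    hStop.comp (tendsto_add_atTop_nat 1)
  have hlim1 : Tendsto (fun n : ℕ => (epoch T (n + 1) ω : ℝ) / n) atTop (𝓝 α) := by
    have h1 : Tendsto (fun n : ℕ => ((n + 1 : ℕ) : ℝ) / n) atTop (𝓝 1) := by
      refine tendsto_div_of_tendsto_sub (r := 1) tendsto_natCast_atTop_atTop ?_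
      exact tendsto_const_nhds.congr fun n => by simp
    have h2 := (hlim.comp (tendsto_add_atTop_nat 1)).mul h1
    rw [mul_one] at h2
    refine h2.congr fun n => ?_
    have h3 : ((n + 1 : ℕ) : ℝ) ≠ 0 := by positivity
    simp only [Function.comp]
    rw [div_mul_div_cancel₀ h3]
  refine ⟨fun h => ?_, fun h => ?_, fun h => ?_, fun h => ?_⟩
  -- Eventual bounds hold at all `t` by monotonicity between epochs; the two frequent bounds below
  -- need only be tested at the epochs themselves.
  · refine limsup_le_of_eventually_le_coe (hU.tendsto_normalized (c := c) hG hα hN1top hN1 hψ) ?_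
    filter_upwards [hr, hL, hN1top.eventually h] with t h1 h2 h3
    refine coe_mul_sub_div_le h1 h2 (le_trans ?_ h3)
    rw [← hm]
    exact runningMax_mono X ω (hN t).2.le
  · refine le_liminf_of_eventually_coe_le (hU.tendsto_normalized (c := c) hG hα hNtop hN0 hψ) ?_
    filter_upwards [hr, hL, hNtop.eventually h] with t h1 h2 h3
    refine le_coe_mul_sub_div h1 h2 (le_trans h3 ?_)
    rw [← hm]
    exact runningMax_mono X ω (hN t).1
  -- Test at the epoch `n + 1`, while the threshold keeps index `n`; the shift is harmless by
  -- `hlim1`.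
  · refine le_limsup_of_frequently_coe_le hS1top
      (hU.tendsto_normalized (c := c) hG hα tendsto_id hlim1 hψ) ?_
    refine (h.and_eventually (hS1top.eventually (hr.and hL))).mono fun n hn => ?_
    refine le_coe_mul_sub_div hn.2.1 hn.2.2 ?_
    rw [hm]
    exact hn.1
  · refine liminf_le_of_frequently_le_coe hStop
      (hU.tendsto_normalized (c := c) hG hα tendsto_id hlim hψ) ?_
    refine (h.and_eventually (hStop.eventually (hr.and hL))).mono fun n hn => ?_
    refine coe_mul_sub_div_le hn.2.1 hn.2.2 ?_
    rw [hm]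
    exact hn.1

/-! ### The i.i.d. cycle maxima and the law of large numbers. -/

section Regenerative

variable {Ω : Type*} [MeasurableSpace Ω] {μ : Measure Ω}
  {E : Type*} [FunLike E ℝ≥0 ℝ] [MeasurableSpace E]
  {T : ℕ → Ω → ℝ≥0} {ξ : ℕ → Ω → E} {X : ℝ≥0 → Ω → ℝ}

/-- The cycle maxima of a regenerative process agree almost surely with an i.i.d. sequence. -/
theorem IsRegenerative.exists_cycleMax (hX : IsRegenerative μ T ξ X)
    (hmax : AEMeasurable (fun p : ℝ≥0 × E => pathSup (fun s => p.2 s) p.1)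
      (μ.map (fun ω => (T 0 ω, ξ 0 ω)))) :
    ∃ Y : ℕ → Ω → EReal, (∀ i, Measurable (Y i)) ∧ iIndepFun Y μ ∧
      (∀ i, IdentDistrib (Y i) (Y 0) μ μ) ∧
      ∀ᵐ ω ∂μ, ∀ n, runningMax X (epoch T n ω) ω = partialMax Y n ω := by
  have hpair : ∀ i, Measurable fun ω => (T i ω, ξ i ω) := fun i =>
    (hX.measurable_length i).prodMk (hX.measurable_path i)
  obtain ⟨g, hg, hgeq⟩ := hmax
  refine ⟨fun i ω => g (T i ω, ξ i ω), fun i => hg.comp (hpair i),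
    hX.indep.comp (fun _ => g) fun _ => hg, fun i => (hX.identDistrib i).comp hg, ?_⟩
  have hae : ∀ᵐ ω ∂μ, ∀ i, pathSup (fun s => ξ i ω s) (T i ω) = g (T i ω, ξ i ω) := by
    refine ae_all_iff.2 fun i => ?_
    -- The null set is given for the law of cycle `0`; every cycle has the same law.
    rw [← (hX.identDistrib i).map_eq] at hgeq
    exact ae_of_ae_map (hpair i).aemeasurable hgeq
  filter_upwards [hae, hX.eq_on_cycle] with ω h1 h2 n
  rw [runningMax_epoch h2]
  exact Finset.sup_congr rfl fun i _ => h1 i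

theorem one_sub_cycleMaxCDF [IsProbabilityMeasure μ] {Y : ℕ → Ω → EReal}
    (hY : Measurable (Y 0))
    (h : ∀ᵐ ω ∂μ, ∀ n, runningMax X (epoch T n ω) ω = partialMax Y n ω) (x : ℝ) :
    1 - cycleMaxCDF μ T X x = μ.real {ω | (x : EReal) < Y 0 ω} := by
  have h1 : cycleMaxCDF μ T X x = μ.real (Y 0 ⁻¹' Set.Iic (x : EReal)) := by
    refine measureReal_congr ?_
    filter_upwards [h] with ω hω
    have h2 := hω 1
    simp only [epoch, partialMax, Finset.range_one, Finset.sum_singleton,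
      Finset.sup_singleton] at h2
    refine propext ?_
    change runningMax X (T 0 ω) ω ≤ (x : EReal) ↔ Y 0 ω ≤ (x : EReal)
    rw [h2]
  rw [h1, ← probReal_compl_eq_one_sub (hY measurableSet_Iic)]
  congr 1
  ext ω
  simp

theorem IsRegenerative.tendsto_epoch_div (hX : IsRegenerative μ T ξ X)
    (hT : Integrable (fun ω => (T 0 ω : ℝ)) μ) :
    ∀ᵐ ω ∂μ, Tendsto (fun n : ℕ => (epoch T n ω : ℝ) / n) atTop (𝓝 (meanCycle μ T)) := by
  have hmeas : Measurable fun p : ℝ≥0 × E => (p.1 : ℝ) :=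
    measurable_fst.coe_nnreal_real
  have h := strong_law_ae_real (fun i ω => (T i ω : ℝ)) hT
    (fun i j hij => (hX.indep.indepFun hij).comp hmeas hmeas)
    fun i => (hX.identDistrib i).comp hmeas
  filter_upwards [h] with ω hω
  refine hω.congr fun n => ?_
  simp [epoch]

theorem IsRegenerative.meanCycle_pos [IsProbabilityMeasure μ] (hX : IsRegenerative μ T ξ X)
    (hT : Integrable (fun ω => (T 0 ω : ℝ)) μ) : 0 < meanCycle μ T := by
  refine (integral_pos_iff_support_of_nonneg (fun ω => NNReal.coe_nonneg (T 0 ω)) hT).2 ?_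
  have h : Function.support (fun ω => (T 0 ω : ℝ)) =ᵐ[μ] Set.univ := by
    refine eventuallyEq_univ.2 ?_
    filter_upwards [hX.length_pos 0] with ω hω
    exact (NNReal.coe_pos.2 hω).ne'
  rw [measure_congr h, measure_univ]
  exact one_pos

end Regenerative

/-! ### Tail bounds and the conclusion. -/

/-- A tail function whose negative logarithm tends to `+∞` along with `R₀` and stays at bounded
distance from it: bounds on left half-lines for `R₀`, and two-sided exponential bounds along the
generalized inverse. -/
theorem ConditionU.tail_bounds {R₀ q : ℝ → ℝ} {C : ℝ} (hR₀ : ConditionU R₀) (hq : Antitone q)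
    (hq0 : ∀ x, 0 ≤ q x) (hR : ∀ x, |-Real.log (q x) - R₀ x| ≤ C) :
    (∀ b : ℝ, ∀ᶠ y in atTop, ∀ x, y < R₀ x → b < x) ∧
      (∀ᶠ y in atTop, Real.exp (-C) * Real.exp (-y) ≤ q (genInv R₀ y)) ∧
      ∀ᶠ y in atTop, q (genInv R₀ y) ≤ Real.exp C * Real.exp (-y) := by
  -- If the tail vanished, the convention `log 0 = 0` would force `|R₀| ≤ C` from there on, against
  -- `R₀ → ∞`.
  have hpos : ∀ x, 0 < q x := fun x => by
    obtain ⟨z, hz, hxz⟩ := ((hR₀.tendsto_atTop.eventually_gt_atTop C).and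
      (eventually_ge_atTop x)).exists
    refine lt_of_le_of_ne (hq0 x) fun h => ?_
    have hz0 : q z = 0 := le_antisymm (h ▸ hq hxz) (hq0 z)
    have h1 := hR z
    rw [hz0, Real.log_zero, neg_zero, zero_sub, abs_neg] at h1
    exact absurd ((le_abs_self _).trans h1) (not_le.2 hz)
  have hb : ∀ b : ℝ, ∀ᶠ y in atTop, ∀ x, y < R₀ x → b < x := fun b => by
    filter_upwards [eventually_ge_atTop (-Real.log (q b) + C)] with y hy x hx
    by_contra! hxb
    have h1 := Real.log_le_log (hpos b) (hq hxb)
    have h2 := (abs_le.1 (hR x)).1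
    linarith
  refine ⟨hb, ?_, ?_⟩
  · filter_upwards [hR₀.eventually_apply_genInv hb] with y hy
    have h1 := (abs_le.1 (hR (genInv R₀ y))).2
    rw [hy] at h1
    rw [← Real.exp_add, ← Real.exp_log (hpos (genInv R₀ y)), Real.exp_le_exp]
    linarith
  · filter_upwards [hR₀.eventually_apply_genInv hb] with y hy
    have h1 := (abs_le.1 (hR (genInv R₀ y))).1
    rw [hy] at h1
    rw [← Real.exp_add, ← Real.exp_log (hpos (genInv R₀ y)), Real.exp_le_exp]
    linarith

theorem tendsto_coe_one_add_const_mul_one_div (a : ℝ) :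
    Tendsto (fun k : ℕ => ((1 + a * (1 / ((k : ℝ) + 1)) : ℝ) : EReal)) atTop (𝓝 1) := by
  have h := ((tendsto_one_div_add_atTop_nhds_zero_nat (𝕜 := ℝ)).const_mul a).const_add 1
  rw [mul_zero, add_zero] at h
  exact (continuous_coe_real_ereal.tendsto (1 : ℝ)).comp h

theorem theorem1 {Ω : Type*} [MeasurableSpace Ω] (μ : Measure Ω) [IsProbabilityMeasure μ]
    {E : Type*} [FunLike E ℝ≥0 ℝ] [MeasurableSpace E]
    (T : ℕ → Ω → ℝ≥0) (ξ : ℕ → Ω → E) (X : ℝ≥0 → Ω → ℝ)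
    (hX : IsRegenerative μ T ξ X)
    -- the maximum over a cycle is a measurable functional of the cycle, up to null sets
    (hmax : AEMeasurable (fun p : ℝ≥0 × E => pathSup (fun s => p.2 s) p.1)
      (μ.map (fun ω => (T 0 ω, ξ 0 ω))))
    -- finite mean cycle length
    (hT : Integrable (fun ω => (T 0 ω : ℝ)) μ)
    (R₀ R₁ : ℝ → ℝ)
    (hR : ∀ x : ℝ, cycleMaxR μ T X x = R₀ x + R₁ x)
    (hR₁ : ∃ C₁ : ℝ, ∀ x : ℝ, |R₁ x| ≤ C₁)
    (hR₀ : ConditionU R₀) :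
    (∀ᵐ ω ∂μ, limsup (fun t : ℝ≥0 =>
        normalizedMax R₀ (meanCycle μ T) X t ω / ((Real.log (Real.log (t : ℝ)) : ℝ) : EReal)) atTop = 1) ∧
    (∀ᵐ ω ∂μ, liminf (fun t : ℝ≥0 =>
        normalizedMax R₀ (meanCycle μ T) X t ω / ((Real.log (Real.log (Real.log (t : ℝ))) : ℝ) : EReal)) atTop
          = -1) := by
  obtain ⟨C, hC⟩ := hR₁
  obtain ⟨Y, hYm, hYind, hYid, hYmax⟩ := hX.exists_cycleMax hmax
  obtain ⟨κ, hU⟩ := hR₀.regularlyVarying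
  have hα := hX.meanCycle_pos hT
  obtain ⟨hb, hlow, hupp⟩ := hR₀.tail_bounds (q := fun x => μ.real {ω | (x : EReal) < Y 0 ω})
    (C := C)
    (fun x z hxz => measureReal_mono fun ω hω => (EReal.coe_le_coe_iff.2 hxz).trans_lt hω)
    (fun x => measureReal_nonneg) fun x => by
      have h1 := hR x
      rw [cycleMaxR, one_sub_cycleMaxCDF (hYm 0) hYmax] at h1
      rw [h1, add_sub_cancel_left]
      exact hC x
  have hG := hR₀.eventually_hasDerivAt_genInv hb
  have hmono := hR₀.exists_monotoneOn_genInv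
  have hlim := hX.tendsto_epoch_div hT
  have hε : ∀ k : ℕ, 0 < 1 / ((k : ℝ) + 1) := fun k => Nat.one_div_pos_of_nat
  constructor
  -- Countably many margins `1 / (k + 1)`, so that one null set serves all of them.
  · have h1 : ∀ᵐ ω ∂μ, ∀ k : ℕ, _ := ae_all_iff.2 fun k : ℕ =>
      ae_eventually_partialMax_le hYid hmono hupp
        (show 1 < 1 + 1 * (1 / ((k : ℝ) + 1)) by linarith [hε k])
    filter_upwards [hYmax, hlim, h1,
      ae_frequently_le_partialMax hYm hYind hYid (Real.exp_pos _) hlow] with ω hm hS h1 h2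
    apply le_antisymm
    · refine ge_of_tendsto' (tendsto_coe_one_add_const_mul_one_div 1) fun k => ?_
      exact (normalizedMax_bounds hU hG hα hS hm logarithmicScale_log).1 (h1 k)
    · refine (normalizedMax_bounds (c := 1) hU hG hα hS hm logarithmicScale_log).2.2.1 ?_
      simpa only [one_mul] using h2
  · have h1 : ∀ᵐ ω ∂μ, ∀ k : ℕ, _ := ae_all_iff.2 fun k : ℕ =>
      ae_eventually_le_partialMax hYm hYind hYid hmono (Real.exp_pos _) hlow
        (show 1 < 1 + 1 * (1 / ((k : ℝ) + 1)) by linarith [hε k])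
    have h2 : ∀ᵐ ω ∂μ, ∀ k : ℕ, _ := ae_all_iff.2 fun k : ℕ =>
      -- The factor `1/2` keeps the constant positive at `k = 0`.
      ae_frequently_partialMax_le (c := 1 + -(1 / 2) * (1 / ((k : ℝ) + 1))) hYm hYind hYid hmono
        (Real.exp_pos _) hupp
        (by
          have : 1 / ((k : ℝ) + 1) ≤ 1 := (div_le_one (by positivity)).2 (by simp)
          linarith)
        (by linarith [hε k])
    filter_upwards [hYmax, hlim, h1, h2] with ω hm hS h1 h2
    have hneg : ∀ a : ℝ, Tendsto (fun k : ℕ => ((-(1 + a * (1 / ((k : ℝ) + 1))) : ℝ) : EReal)) atTop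
        (𝓝 (-1)) := fun a =>
      (continuous_neg.tendsto (1 : EReal)).comp (tendsto_coe_one_add_const_mul_one_div a)
    apply le_antisymm
    · refine ge_of_tendsto' (hneg (-(1 / 2))) fun k => ?_
      refine (normalizedMax_bounds hU hG hα hS hm logarithmicScale_log_log).2.2.2 ?_
      simpa only [neg_mul, ← sub_eq_add_neg] using h2 k
    · refine le_of_tendsto' (hneg 1) fun k => ?_
      refine (normalizedMax_bounds hU hG hα hS hm logarithmicScale_log_log).2.1 ?_
      simpa only [neg_mul, ← sub_eq_add_neg] using h1 k
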